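/- Let $Q$ be a finite-dimensional smooth manifold with a Riemannian metric $\kappa$, and let $D\subset TQ$ be a smooth subbundle of constant rank (the constraints of a nonholonomic system). Let $\mathrm{Leg}:TQ\to T^*Q$, $\mathrm{Leg}(v)=\kappa(v,\cdot)$, let $\mathcal M=\mathrm{Leg}(D)\subset T^*Q$, a vector subbundle of $T^*Q$ with projection $\tau:\mathcal M\to Q$ and inclusion $\iota:\mathcal M\to T^*Q$, and put $\Omega_{\mathcal M}=\iota^*\Omega_Q$, where $\Omega_Q=-d\Theta_Q$ is the canonical 2-form and $\Theta_Q$ the Liouville 1-form of $T^*Q$. Let $\mathcal C\subset T\mathcal M$ be the distribution $\mathcal C_m=\{v\in T_m\mathcal M: T\tau(v)\in D_{\tau(m)}\}$; the restriction $\Omega_{\mathcal M}|_{\mathcal C}$ is nondegenerate. For a bivector field $\pi$ write $\beta(\pi^\sharp(\alpha))=\pi(\alpha,\beta)$ and $\{f,g\}=\pi(df,dg)$, and let $[\pi,\pi]$ be the Schouten bracket, normalized by $\tfrac12[\pi,\pi](df,dg,dh)=\{f,\{g,h\}\}+\{g,\{h,f\}\}+\{h,\{f,g\}\}$. The nonholonomic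 bivector field $\pi_{nh}$ on $\mathcal M$ is defined by: $\pi_{nh}^\sharp(\alpha)=-X$, where $X\in\mathcal C$ is the unique vector with $(\mathbf i_X\Omega_{\mathcal M})|_{\mathcal C}=\alpha|_{\mathcal C}$. Let $\mathcal W\subset T\mathcal M$ be a smooth subbundle with $T\mathcal M=\mathcal C\oplus\mathcal W$, with projections $P_{\mathcal C}$, $P_{\mathcal W}$. Then $\mathbf K_{\mathcal W}(X,Y)=-P_{\mathcal W}[P_{\mathcal C}X,P_{\mathcal C}Y]$, for vector fields $X,Y$ on $\mathcal M$, depends at each point only on the values of $X$ and $Y$ at that point, so that $\mathbf K_{\mathcal W}$ is defined on tangent vectors. Let $B$ be a smooth 2-form on $\mathcal M$ with $\mathbf i_ZB=0$ for all $Z\in\mathcal W$, such that the endomorphism $\mathrm{Id}+B^\flat\circ\pi_{nh}^\sharp$ of $T^*\mathcal M$ is invertible, where $B^\flat(X)=\mathbf i_XB$, and let $\pi_B$ be the gauge transformation of $\pi_{nh}$ by $B$, i.e. $\pi_B^\sharp=\pi_{nh}^\sharp\circ(\mathrm{Id}+B^\flat\circ\pi_{nh}^\sharp)^{-1}$. Then,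 for all $m\in\mathcal M$ and all $\alpha,\beta,\gamma\in T_m^*\mathcal M$, $$\tfrac12[\pi_B,\pi_B](\alpha,\beta,\gamma)=\mathrm{cycl.}\Big[\Omega_{\mathcal M}\big(\mathbf K_{\mathcal W}(\pi_B^\sharp\alpha,\pi_B^\sharp\beta),\pi_B^\sharp\gamma\big)-\gamma\big(\mathbf K_{\mathcal W}(\pi_B^\sharp\alpha,\pi_B^\sharp\beta)\big)\Big]+dB\big(\pi_B^\sharp\alpha,\pi_B^\sharp\beta,\pi_B^\sharp\gamma\big),$$ where cycl. denotes the sum over the cyclic permutations of $(\alpha,\beta,\gamma)$. -/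

import Mathlib

noncomputable section

namespace Nonholonomic

open Bundle Set Function
open scoped Manifold ContDiff Topology

section Distributions

variable {E : Type*} [NormedAddCommGroup E] [NormedSpace ℝ E] {H : Type*} [TopologicalSpace H]
  {I : ModelWithCorners ℝ E H} {M : Type*} [TopologicalSpace M] [ChartedSpace H M]

/-- A smooth local frame of rank `r` of a family `D` of subspaces of the tangent spaces: smooth
vector fields on an open set that form a basis of `D x` at every point `x` of that set. -/
structure LocalFrame [IsManifold I ∞ M] (D : ∀ x : M, Submodule ℝ (TangentSpace I x)) (r : ℕ) where
  baseSet : Set M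
  isOpen_baseSet : IsOpen baseSet
  field : Fin r → ∀ x : M, TangentSpace I x
  smooth : ∀ i, ContMDiffOn I I.tangent ∞
    (fun x ↦ (TotalSpace.mk' E x (field i x) : TangentBundle I M)) baseSet
  linearIndependent : ∀ x ∈ baseSet, LinearIndependent ℝ fun i ↦ field i x
  span_eq : ∀ x ∈ baseSet, Submodule.span ℝ (range fun i ↦ field i x) = D x

variable (I M) in
/-- A regular smooth distribution of rank `r`, i.e. a smooth rank `r` subbundle of `TM`. -/
structure RegularDistribution [IsManifold I ∞ M] (r : ℕ) where
  fiber : ∀ x : M, Submodule ℝ (TangentSpace I x)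
  exists_frame : ∀ x : M, ∃ f : LocalFrame fiber r, x ∈ f.baseSet

end Distributions

theorem contMDiffOn_det {E : Type*} [NormedAddCommGroup E] [NormedSpace ℝ E]
    {Q : Type*} [TopologicalSpace Q] [ChartedSpace E Q] {r : ℕ} {s : Set Q}
    {A : Q → Matrix (Fin r) (Fin r) ℝ}
    (hA : ∀ i j, ContMDiffOn 𝓘(ℝ, E) 𝓘(ℝ, ℝ) ∞ (fun q ↦ A q i j) s) :
    ContMDiffOn 𝓘(ℝ, E) 𝓘(ℝ, ℝ) ∞ (fun q ↦ (A q).det) s := by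
  simp only [Matrix.det_apply']
  refine contMDiffOn_finsetSum fun σ _ ↦ ?_
  exact contMDiffOn_const.mul (contMDiffOn_finsetProd fun i _ ↦ hA _ _)

section ConstraintManifold

variable {E : Type*} [NormedAddCommGroup E] [NormedSpace ℝ E]
  {Q : Type*} [TopologicalSpace Q] [ChartedSpace E Q] [IsManifold 𝓘(ℝ, E) ∞ Q] {r : ℕ}

/-- The kinetic energy metric: a smooth Riemannian metric on `Q`. -/
abbrev KineticMetric (E : Type*) [NormedAddCommGroup E] [NormedSpace ℝ E]
    (Q : Type*) [TopologicalSpace Q] [ChartedSpace E Q] [IsManifold 𝓘(ℝ, E) ∞ Q] : Type _ :=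
  ContMDiffRiemannianMetric 𝓘(ℝ, E) ∞ E (fun q : Q ↦ TangentSpace 𝓘(ℝ, E) q)

/-- The fiber `Leg (D_q) ⊆ T*_q Q` of the constraint submanifold, where the Legendre transform is
`v ↦ κ(v, ·)`. -/
def legSubmodule (κ : KineticMetric E Q) (D : RegularDistribution 𝓘(ℝ, E) Q r) (q : Q) :
    Submodule ℝ (TangentSpace 𝓘(ℝ, E) q →L[ℝ] ℝ) :=
  (D.fiber q).map (κ.inner q : TangentSpace 𝓘(ℝ, E) q →ₗ[ℝ] TangentSpace 𝓘(ℝ, E) q →L[ℝ] ℝ)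

/-- `legSubmodule` as a family of types over `Q`. -/
def LegFiber (κ : KineticMetric E Q) (D : RegularDistribution 𝓘(ℝ, E) Q r) (q : Q) : Type _ :=
  legSubmodule κ D q

variable (κ : KineticMetric E Q) (D : RegularDistribution 𝓘(ℝ, E) Q r)

instance (q : Q) : AddCommGroup (LegFiber κ D q) :=
  inferInstanceAs (AddCommGroup (legSubmodule κ D q))
instance (q : Q) : Module ℝ (LegFiber κ D q) :=
  inferInstanceAs (Module ℝ (legSubmodule κ D q))
instance (q : Q) : TopologicalSpace (LegFiber κ D q) :=
  inferInstanceAs (TopologicalSpace (legSubmodule κ D q))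
instance (q : Q) : IsTopologicalAddGroup (LegFiber κ D q) :=
  inferInstanceAs (IsTopologicalAddGroup (legSubmodule κ D q))
instance (q : Q) : ContinuousSMul ℝ (LegFiber κ D q) :=
  inferInstanceAs (ContinuousSMul ℝ (legSubmodule κ D q))
instance (q : Q) : T2Space (LegFiber κ D q) :=
  have : T2Space (TangentSpace 𝓘(ℝ, E) q →L[ℝ] ℝ) := inferInstanceAs (T2Space (E →L[ℝ] ℝ))
  inferInstanceAs (T2Space (legSubmodule κ D q))

variable {κ D}

theorem LocalFrame.exists_eq_sum (f : LocalFrame D.fiber r) {q : Q} (hq : q ∈ f.baseSet)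
    {v : TangentSpace 𝓘(ℝ, E) q} (hv : v ∈ D.fiber q) :
    ∃ c : Fin r → ℝ, v = ∑ i, c i • f.field i q := by
  rw [← f.span_eq q hq] at hv
  obtain ⟨c, hc⟩ := (Submodule.mem_span_range_iff_exists_fun ℝ).1 hv
  exact ⟨c, hc.symm⟩

theorem LocalFrame.mem (f : LocalFrame D.fiber r) {q : Q} (hq : q ∈ f.baseSet) (i : Fin r) :
    f.field i q ∈ D.fiber q := by
  rw [← f.span_eq q hq]; exact Submodule.subset_span ⟨i, rfl⟩

/-- The coordinates `p ↦ (p (s₁), …, p (s_r))` on the fiber of the constraint submanifold that a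
local frame `s₁, …, s_r` of `D` defines. -/
def LocalFrame.eval (f : LocalFrame D.fiber r) (q : Q) : LegFiber κ D q →ₗ[ℝ] (Fin r → ℝ) where
  toFun p i := p.1 (f.field i q)
  map_add' _ _ := rfl
  map_smul' _ _ := rfl

theorem LocalFrame.eval_injective (f : LocalFrame D.fiber r) {q : Q} (hq : q ∈ f.baseSet) :
    Injective (f.eval (κ := κ) q) := by
  rw [injective_iff_map_eq_zero]
  rintro ⟨p, v, hv, rfl⟩ h
  obtain ⟨c, hc⟩ := f.exists_eq_sum hq hv
  have h0 : ∀ i, κ.inner q v (f.field i q) = 0 := fun i ↦ congrFun h i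
  have hvv : κ.inner q v v = 0 := by
    have : κ.inner q v (∑ i, c i • f.field i q) = 0 := by simp [map_sum, h0]
    rwa [← hc] at this
  have hv0 : v = 0 := by
    by_contra hne
    exact (κ.pos q v hne).ne' hvv
  subst hv0
  exact Subtype.ext (map_zero _)

theorem LocalFrame.eval_bijective (f : LocalFrame D.fiber r) {q : Q} (hq : q ∈ f.baseSet) :
    Bijective (f.eval (κ := κ) q) := by
  have hκ : Injective (κ.inner q) := by
    rw [injective_iff_map_eq_zero]
    intro v hv
    by_contra hne
    have := κ.pos q v hne
    simp [hv] at this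
  have hfin : Module.finrank ℝ (D.fiber q) = r := by
    rw [← f.span_eq q hq, finrank_span_eq_card (f.linearIndependent q hq), Fintype.card_fin]
  have : FiniteDimensional ℝ (D.fiber q) := by
    rw [← f.span_eq q hq]; exact FiniteDimensional.span_of_finite ℝ (finite_range _)
  let e : D.fiber q ≃ₗ[ℝ] LegFiber κ D q := Submodule.equivMapOfInjective _ hκ _
  have : FiniteDimensional ℝ (LegFiber κ D q) := e.finiteDimensional
  refine ⟨f.eval_injective hq, ?_⟩
  refine (LinearMap.injective_iff_surjective_of_finrank_eq_finrank ?_).1 (f.eval_injective hq)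
  rw [← e.finrank_eq, hfin]; simp

open Classical in
/-- The local trivialization of the constraint submanifold defined by a local frame of `D`. -/
def LocalFrame.pretrivialization (f : LocalFrame D.fiber r) :
    Pretrivialization (Fin r → ℝ) (π (Fin r → ℝ) (LegFiber κ D)) where
  toFun z := (z.1, f.eval z.1 z.2)
  invFun z := if h : z.1 ∈ f.baseSet then
      ⟨z.1, (LinearEquiv.ofBijective (f.eval z.1) (f.eval_bijective h)).symm z.2⟩ else ⟨z.1, 0⟩
  source := π (Fin r → ℝ) (LegFiber κ D) ⁻¹' f.baseSet
  target := f.baseSet ×ˢ univ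
  baseSet := f.baseSet
  open_baseSet := f.isOpen_baseSet
  open_target := f.isOpen_baseSet.prod isOpen_univ
  source_eq := rfl
  target_eq := rfl
  proj_toFun _ _ := rfl
  map_source' _ hz := ⟨hz, mem_univ _⟩
  map_target' z hz := by
    have : z.1 ∈ f.baseSet := hz.1
    simp [this]
  left_inv' z hz := by
    have hz' : z.1 ∈ f.baseSet := hz
    rw [dif_pos hz']
    refine TotalSpace.ext rfl (heq_of_eq ?_)
    exact (LinearEquiv.ofBijective _ (f.eval_bijective hz')).symm_apply_apply z.2
  right_inv' z hz := by
    have hz' : z.1 ∈ f.baseSet := hz.1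
    rw [dif_pos hz']
    refine Prod.ext rfl ?_
    exact (LinearEquiv.ofBijective _ (f.eval_bijective hz')).apply_symm_apply z.2

theorem LocalFrame.pretrivialization_apply (f : LocalFrame D.fiber r) (q : Q) (p : LegFiber κ D q) :
    f.pretrivialization ⟨q, p⟩ = (q, f.eval q p) := rfl

instance (f : LocalFrame D.fiber r) : (f.pretrivialization (κ := κ)).IsLinear ℝ where
  linear q _ := (f.eval (κ := κ) q).isLinear

theorem LocalFrame.eval_symm (f : LocalFrame D.fiber r) {q : Q} (hq : q ∈ f.baseSet)
    (c : Fin r → ℝ) : f.eval q ((f.pretrivialization (κ := κ)).symm q c) = c := by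
  have h := (f.pretrivialization (κ := κ)).apply_mk_symm (b := q) hq c
  exact congrArg Prod.snd h

variable (κ) in
/-- Gram matrix of two local frames. -/
def LocalFrame.gram (f g : LocalFrame D.fiber r) (q : Q) : Matrix (Fin r) (Fin r) ℝ :=
  fun i j ↦ κ.inner q (f.field i q) (g.field j q)

theorem LocalFrame.contMDiffOn_gram (f g : LocalFrame D.fiber r) (i j : Fin r) :
    ContMDiffOn 𝓘(ℝ, E) 𝓘(ℝ, ℝ) ∞ (fun q ↦ f.gram κ g q i j) (f.baseSet ∩ g.baseSet) := by
  have h1 := (f.smooth i).mono (inter_subset_left (t := g.baseSet))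
  have h2 := (g.smooth j).mono (inter_subset_right (s := f.baseSet))
  have h := ContMDiffOn.clm_bundle_apply₂ (F₁ := E) (F₂ := E) (F₃ := ℝ)
    (E₁ := fun q : Q ↦ TangentSpace 𝓘(ℝ, E) q) (E₂ := fun q : Q ↦ TangentSpace 𝓘(ℝ, E) q)
    (E₃ := Trivial Q ℝ) (b := fun q ↦ q) (ψ := fun q ↦ κ.inner q)
    κ.contMDiff.contMDiffOn h1 h2
  exact fun q hq ↦ (contMDiffWithinAt_totalSpace.1 (h q hq)).2

theorem LocalFrame.det_gram_ne_zero (f : LocalFrame D.fiber r) {q : Q} (hq : q ∈ f.baseSet) :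
    (f.gram κ f q).det ≠ 0 := by
  intro h0
  obtain ⟨c, hc, hc0⟩ := Matrix.exists_mulVec_eq_zero_iff.2 h0
  set v := ∑ i, c i • f.field i q with hv
  have hvf : ∀ i, κ.inner q (f.field i q) v = 0 := by
    intro i
    have := congrFun hc0 i
    simp only [Matrix.mulVec, dotProduct, gram, Pi.zero_apply] at this
    simp only [hv, map_sum, map_smul, smul_eq_mul, ← this, mul_comm]
  have hvv : κ.inner q v v = 0 := by
    have : κ.inner q v (∑ i, c i • f.field i q) = 0 := by
      have h' : ∀ i, κ.inner q v (f.field i q) = 0 := fun i ↦ by rw [κ.symm, hvf]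
      simp [map_sum, h']
    rwa [← hv] at this
  have hv0 : v = 0 := by
    by_contra hne
    exact (κ.pos q v hne).ne' hvv
  exact hc (funext fun i ↦ Fintype.linearIndependent_iff.1 (f.linearIndependent q hq) c hv0 i)

variable (κ) in
/-- Change of coordinates between the trivializations of two local frames. -/
def LocalFrame.change (f g : LocalFrame D.fiber r) (q : Q) : (Fin r → ℝ) →L[ℝ] (Fin r → ℝ) :=
  ∑ j, ∑ i, (∑ k, g.gram κ f q j k * (((f.gram κ f q).det)⁻¹ * (f.gram κ f q).adjugate k i)) •
    (ContinuousLinearMap.proj i : (Fin r → ℝ) →L[ℝ] ℝ).smulRight (Pi.single j (1 : ℝ))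

theorem LocalFrame.contMDiffOn_change (f g : LocalFrame D.fiber r) :
    ContMDiffOn 𝓘(ℝ, E) 𝓘(ℝ, (Fin r → ℝ) →L[ℝ] (Fin r → ℝ)) ∞ (f.change κ g)
      (f.baseSet ∩ g.baseSet) := by
  have hff : ∀ i j, ContMDiffOn 𝓘(ℝ, E) 𝓘(ℝ, ℝ) ∞ (fun q ↦ f.gram κ f q i j)
      (f.baseSet ∩ g.baseSet) := fun i j ↦
    (f.contMDiffOn_gram f i j).mono fun q hq ↦ ⟨hq.1, hq.1⟩
  have hgf : ∀ i j, ContMDiffOn 𝓘(ℝ, E) 𝓘(ℝ, ℝ) ∞ (fun q ↦ g.gram κ f q i j)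
      (f.baseSet ∩ g.baseSet) := fun i j ↦
    (g.contMDiffOn_gram f i j).mono fun q hq ↦ ⟨hq.2, hq.1⟩
  unfold change
  refine contMDiffOn_finsetSum fun j _ ↦ contMDiffOn_finsetSum fun i _ ↦ ?_
  have hA : ContMDiffOn 𝓘(ℝ, E) 𝓘(ℝ, ℝ) ∞ (fun q ↦ ∑ k, g.gram κ f q j k *
      (((f.gram κ f q).det)⁻¹ * (f.gram κ f q).adjugate k i)) (f.baseSet ∩ g.baseSet) := by
    refine contMDiffOn_finsetSum fun k _ ↦ (hgf j k).mul (ContMDiffOn.mul ?_ ?_)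
    · exact (contMDiffOn_det hff).inv₀ fun q hq ↦ f.det_gram_ne_zero hq.1
    · simp only [Matrix.adjugate_apply]
      refine contMDiffOn_det fun a b ↦ ?_
      by_cases h : a = i
      · simp only [h, Matrix.updateRow_self]; exact contMDiffOn_const
      · simpa [Matrix.updateRow_ne h] using hff a b
  have hc : ContMDiffOn 𝓘(ℝ, E) 𝓘(ℝ, (Fin r → ℝ) →L[ℝ] (Fin r → ℝ)) ∞
      (fun _ : Q ↦ (ContinuousLinearMap.proj i : (Fin r → ℝ) →L[ℝ] ℝ).smulRight
        (Pi.single j (1 : ℝ) : Fin r → ℝ)) (f.baseSet ∩ g.baseSet) := contMDiffOn_const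
  exact hA.smul hc

theorem LocalFrame.change_apply (f g : LocalFrame D.fiber r) {q : Q}
    (hq : q ∈ f.baseSet ∩ g.baseSet) (p : LegFiber κ D q) :
    f.change κ g q (f.eval q p) = g.eval q p := by
  funext j
  obtain ⟨a, ha⟩ := f.exists_eq_sum hq.1 (g.mem hq.2 j)
  have hG : ∀ k, g.gram κ f q j k = ∑ i, a i * f.gram κ f q i k := by
    intro k
    simp only [gram, ha, map_sum, map_smul, sum_apply,
      smul_apply, smul_eq_mul]
  have hA : ∀ i, ∑ k, g.gram κ f q j k * (((f.gram κ f q).det)⁻¹ *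
      (f.gram κ f q).adjugate k i) = a i := by
    intro i
    have h1 := Matrix.mul_adjugate (f.gram κ f q)
    have h2 := f.det_gram_ne_zero (κ := κ) hq.1
    have h3 : (fun k ↦ g.gram κ f q j k) = Matrix.vecMul a (f.gram κ f q) := by
      funext k; rw [hG]; rfl
    calc _ = ((f.gram κ f q).det)⁻¹ *
          Matrix.vecMul (fun k ↦ g.gram κ f q j k) (f.gram κ f q).adjugate i := by
            simp only [Matrix.vecMul, dotProduct, Finset.mul_sum]
            exact Finset.sum_congr rfl fun k _ ↦ by ring
      _ = a i := by
            rw [h3, Matrix.vecMul_vecMul, h1]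
            simp [Matrix.vecMul_smul, h2]
  have : g.eval q p j = ∑ i, a i * f.eval q p i := by
    change p.1 (g.field j q) = ∑ i, a i * p.1 (f.field i q)
    simp [ha, map_sum]
  rw [this]
  simp [change, hA, Pi.single_apply]

theorem LocalFrame.change_eq (f g : LocalFrame D.fiber r) {q : Q}
    (hq : q ∈ f.baseSet ∩ g.baseSet) (c : Fin r → ℝ) :
    f.change κ g q c =
      (g.pretrivialization (κ := κ) ⟨q, (f.pretrivialization (κ := κ)).symm q c⟩).2 := by
  conv_lhs => rw [← f.eval_symm (κ := κ) hq.1 c]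
  exact f.change_apply g hq _

variable (κ D) in
/-- The constraint submanifold as a vector bundle over `Q`: its local trivializations are those
given by the smooth local frames of `D`. -/
def legPrebundle : VectorPrebundle ℝ (Fin r → ℝ) (LegFiber κ D) where
  pretrivializationAtlas := range fun f : LocalFrame D.fiber r ↦ f.pretrivialization
  pretrivialization_linear' := by rintro _ ⟨f, rfl⟩; infer_instance
  pretrivializationAt q := (D.exists_frame q).choose.pretrivialization
  mem_base_pretrivializationAt q := (D.exists_frame q).choose_spec
  pretrivialization_mem_atlas q := ⟨_, rfl⟩
  exists_coordChange := by
    rintro _ ⟨f, rfl⟩ _ ⟨g, rfl⟩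
    exact ⟨f.change κ g, (f.contMDiffOn_change g).continuousOn, fun q hq c ↦ f.change_eq g hq c⟩
  totalSpaceMk_isInducing q := by
    have hb := (D.exists_frame q).choose.eval_bijective (κ := κ) (D.exists_frame q).choose_spec
    let e := LinearEquiv.ofBijective _ hb
    have : FiniteDimensional ℝ (LegFiber κ D q) := e.symm.finiteDimensional
    exact Topology.isInducing_const_prod.mpr e.toContinuousLinearEquiv.toHomeomorph.isInducing

instance : TopologicalSpace (TotalSpace (Fin r → ℝ) (LegFiber κ D)) :=
  (legPrebundle κ D).totalSpaceTopology

instance : FiberBundle (Fin r → ℝ) (LegFiber κ D) := (legPrebundle κ D).toFiberBundle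

instance : VectorBundle ℝ (Fin r → ℝ) (LegFiber κ D) := (legPrebundle κ D).toVectorBundle

instance : (legPrebundle κ D).IsContMDiff 𝓘(ℝ, E) ∞ where
  exists_contMDiffCoordChange := by
    rintro _ ⟨f, rfl⟩ _ ⟨g, rfl⟩
    exact ⟨f.change κ g, f.contMDiffOn_change g, fun q hq c ↦ f.change_eq g hq c⟩

instance : ContMDiffVectorBundle ∞ (Fin r → ℝ) (LegFiber κ D) 𝓘(ℝ, E) :=
  (legPrebundle κ D).contMDiffVectorBundle 𝓘(ℝ, E)


end ConstraintManifold

section Forms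

variable {E : Type*} [NormedAddCommGroup E] [NormedSpace ℝ E] {H : Type*} [TopologicalSpace H]
  {I : ModelWithCorners ℝ E H} {M : Type*} [TopologicalSpace M] [ChartedSpace H M]
  {E' : Type*} [NormedAddCommGroup E'] [NormedSpace ℝ E'] {H' : Type*} [TopologicalSpace H']
  {I' : ModelWithCorners ℝ E' H'} {M' : Type*} [TopologicalSpace M'] [ChartedSpace H' M']
  {k : ℕ}

variable (I M) in
/-- (Not necessarily smooth) differential `k`-forms on a manifold. -/
abbrev DiffForm (k : ℕ) : Type _ := ∀ x : M, TangentSpace I x [⋀^Fin k]→L[ℝ] ℝ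

/-- Pullback `f^* η` of a differential form. -/
def DiffForm.pullback (f : M → M') (η : DiffForm I' M' k) : DiffForm I M k :=
  fun x ↦ (η (f x)).compContinuousLinearMap (mfderiv I I' f x)

/-- The form `η` written in the chart at `x`. -/
def DiffForm.inChart (η : DiffForm I M k) (x : M) : E → E [⋀^Fin k]→L[ℝ] ℝ :=
  η.pullback (I := 𝓘(ℝ, E)) (extChartAt I x).symm

/-- Smoothness of a differential form (on a manifold without boundary). -/
def DiffForm.IsSmooth (η : DiffForm I M k) : Prop :=
  ∀ x : M, ContDiffAt ℝ ∞ (η.inChart x) (extChartAt I x x)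

/-- Exterior derivative of a differential form (on a manifold without boundary), computed at `x` in
the chart at `x`. -/
def DiffForm.d (η : DiffForm I M k) : DiffForm I M (k + 1) := fun x ↦
  (extDeriv (η.inChart x) (extChartAt I x x)).compContinuousLinearMap
    (mfderiv I 𝓘(ℝ, E) (extChartAt I x) x)

theorem update_one {V : Type*} (v u w : V) : update ![v, u] 1 w = ![v, w] := by
  funext i; fin_cases i <;> rfl

theorem update_zero {V : Type*} (v u w : V) : update ![u, w] 0 v = ![v, w] := by
  funext i; fin_cases i <;> rfl

/-- The map `B^♭ : T_x M → T*_x M`, `v ↦ i_v B`. -/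
def flat {x : M} (B : TangentSpace I x [⋀^Fin 2]→L[ℝ] ℝ) :
    TangentSpace I x →ₗ[ℝ] (TangentSpace I x →L[ℝ] ℝ) where
  toFun v :=
    { toFun := fun w ↦ B ![v, w]
      map_add' := fun w w' ↦ by
        have h := B.map_update_add ![v, 0] 1 w w'
        rwa [update_one, update_one, update_one] at h
      map_smul' := fun c w ↦ by
        have h := B.map_update_smul ![v, 0] 1 c w
        rwa [update_one, update_one] at h
      cont := B.cont.comp (by fun_prop) }
  map_add' v v' := by
    ext w
    have h := B.map_update_add ![0, w] 0 v v'
    rwa [update_zero, update_zero, update_zero] at h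
  map_smul' c v := by
    ext w
    have h := B.map_update_smul ![0, w] 0 c v
    rwa [update_zero, update_zero] at h

end Forms

section Bivectors

variable {E : Type*} [NormedAddCommGroup E] [NormedSpace ℝ E] {H : Type*} [TopologicalSpace H]
  {I : ModelWithCorners ℝ E H} {M : Type*} [TopologicalSpace M] [ChartedSpace H M]

variable (I M) in
/-- A bivector field `Λ`, represented by the maps `Λ^♯ : T*_x M → T_x M`, where
`β (Λ^♯ α) = Λ (α, β)`. -/
abbrev Bivector : Type _ := ∀ x : M, (TangentSpace I x →L[ℝ] ℝ) →ₗ[ℝ] TangentSpace I x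

/-- The bracket `{f, g} = Λ (df, dg)`. -/
def Bivector.bracket (Λ : Bivector I M) (f g : M → ℝ) : M → ℝ :=
  fun x ↦ mvfderiv I g x (Λ x (mvfderiv I f x))

/-- The function near `x`, linear in the chart at `x`, whose differential at `x` is the
covector `a`. (The tangent space at `x` is by definition the model space `E`, and the derivative at
`x` of the chart at `x` is the identity; see `mvfderiv_coordFun`.) -/
def coordFun (x : M) (a : TangentSpace I x →L[ℝ] ℝ) : M → ℝ :=
  fun y ↦ a (show E from extChartAt I x y)

theorem mvfderiv_coordFun [IsManifold I 1 M] (x : M) (a : TangentSpace I x →L[ℝ] ℝ) :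
    mvfderiv I (coordFun x a) x = a := by
  have h1 : MDifferentiableAt I 𝓘(ℝ, ℝ) (coordFun x a) x :=
    (show E →L[ℝ] ℝ from a).mdifferentiableAt.comp x
      (mdifferentiableAt_extChartAt (mem_chart_source H x))
  have h2 : ∀ y ∈ (extChartAt I x).target, writtenInExtChartAt I 𝓘(ℝ, ℝ) x (coordFun x a) y =
      (show E →L[ℝ] ℝ from a) y := fun y hy ↦
    congrArg (show E →L[ℝ] ℝ from a) ((extChartAt I x).right_inv hy)
  rw [h1.mvfderiv, Filter.EventuallyEq.fderivWithin_eq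
    (Filter.eventually_of_mem (extChartAt_target_mem_nhdsWithin x) h2)
    (h2 _ (mem_extChartAt_target x))]
  exact (show E →L[ℝ] ℝ from a).hasFDerivWithinAt.fderivWithin
    (I.uniqueDiffOn _ (mem_range_self _))

/-- The Schouten bracket `[Λ₁, Λ₂]` of two bivector fields, as a trivector field. At `x`, and for
functions `f`, `g`, `h` that are linear in the chart at `x`, it is given by
`[Λ₁, Λ₂] (df, dg, dh) = {f, {g, h}₂}₁ + {f, {g, h}₁}₂ + cyclic permutations of f, g, h`.
In particular `½ [Λ, Λ] (df, dg, dh) = {f, {g, h}} + {g, {h, f}} + {h, {f, g}}`. -/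
def schouten (Λ₁ Λ₂ : Bivector I M) (x : M) (α β γ : TangentSpace I x →L[ℝ] ℝ) : ℝ :=
  let f := coordFun x α
  let g := coordFun x β
  let h := coordFun x γ
  (Λ₁.bracket f (Λ₂.bracket g h) x + Λ₂.bracket f (Λ₁.bracket g h) x) +
  (Λ₁.bracket g (Λ₂.bracket h f) x + Λ₂.bracket g (Λ₁.bracket h f) x) +
  (Λ₁.bracket h (Λ₂.bracket f g) x + Λ₂.bracket h (Λ₁.bracket f g) x)

/-- The restriction of a 2-form `Ω` to a subspace `F`, as the map `F → F*`, `X ↦ (i_X Ω)|_F`. -/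
def restrictForm {x : M} (Ω : TangentSpace I x [⋀^Fin 2]→L[ℝ] ℝ)
    (F : Submodule ℝ (TangentSpace I x)) : F →ₗ[ℝ] Module.Dual ℝ F :=
  F.dualRestrict ∘ₗ ContinuousLinearMap.coeLM ℝ ∘ₗ flat Ω ∘ₗ F.subtype

open Classical in
/-- The bivector field defined by a family `F` of subspaces and a 2-form `Ω` whose restriction to
`F` is nondegenerate: `Λ^♯ α = -X`, where `X ∈ F` is the unique vector with
`(i_X Ω)|_F = α|_F`. (It is zero at points where `Ω|_F` is degenerate.) -/
def bivectorOfForm (F : ∀ x : M, Submodule ℝ (TangentSpace I x)) (Ω : DiffForm I M 2) :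
    Bivector I M := fun x ↦
  if h : Bijective (restrictForm (Ω x) (F x)) then
    -((F x).subtype ∘ₗ (LinearEquiv.ofBijective _ h).symm.toLinearMap ∘ₗ
      (F x).dualRestrict ∘ₗ ContinuousLinearMap.coeLM ℝ)
  else 0

/-- The endomorphism `Id + B^♭ ∘ Λ^♯` of `T*_x M`. -/
def gaugeEnd (Λ : Bivector I M) (B : DiffForm I M 2) (x : M) :
    Module.End ℝ (TangentSpace I x →L[ℝ] ℝ) :=
  LinearMap.id + flat (B x) ∘ₗ Λ x

/-- `Λ_B` is the gauge transformation of `Λ` by the 2-form `B`: the endomorphism `Id + B^♭ ∘ Λ^♯` is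
invertible, and `Λ_B^♯ = Λ^♯ ∘ (Id + B^♭ ∘ Λ^♯)⁻¹`. -/
def IsGaugeTransform (Λ : Bivector I M) (B : DiffForm I M 2) (ΛB : Bivector I M) : Prop :=
  ∀ x, IsUnit (gaugeEnd Λ B x) ∧ ΛB x = Λ x ∘ₗ Ring.inverse (gaugeEnd Λ B x)

variable [IsManifold I 1 M] {C W : ∀ x : M, Submodule ℝ (TangentSpace I x)}

/-- The vector field `K_W (X, Y) = -P_W [P_C X, P_C Y]` of a splitting `TM = C ⊕ W`. -/
def curvatureField (h : ∀ x, IsCompl (C x) (W x)) (X Y : ∀ x : M, TangentSpace I x) (x : M) :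
    TangentSpace I x :=
  -(W x).projection (C x) (h x).symm (VectorField.mlieBracket I
    (fun y ↦ (C y).projection (W y) (h y) (X y)) (fun y ↦ (C y).projection (W y) (h y) (Y y)) x)

/-- The value `K_W (u, v)` on two tangent vectors at `x`, computed by extending them to vector
fields near `x`. -/
def curvature (h : ∀ x, IsCompl (C x) (W x)) (x : M) (u v : TangentSpace I x) : TangentSpace I x :=
  curvatureField h (FiberBundle.extend E u) (FiberBundle.extend E v) x

end Bivectors

section NonholonomicSystem

variable {E : Type*} [NormedAddCommGroup E] [NormedSpace ℝ E]
  {Q : Type*} [TopologicalSpace Q] [ChartedSpace E Q] [IsManifold 𝓘(ℝ, E) ∞ Q] {r : ℕ}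

variable (E Q) in
/-- The cotangent bundle `T*Q`. -/
abbrev Cotangent : Type _ :=
  TotalSpace (E →L[ℝ] ℝ) (fun q : Q ↦ TangentSpace 𝓘(ℝ, E) q →L[ℝ] ℝ)

variable (E) in
/-- The model with corners of the manifold `T*Q`. -/
abbrev cotangentModel := 𝓘(ℝ, E).prod 𝓘(ℝ, E →L[ℝ] ℝ)

variable (E Q) in
/-- The Liouville 1-form `θ` on `T*Q`: `θ_{(q, p)} (ξ) = p (Tτ ξ)`, where `τ : T*Q → Q` is the
projection. -/
def liouvilleForm : DiffForm (cotangentModel E) (Cotangent E Q) 1 := fun z ↦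
  ContinuousAlternatingMap.ofSubsingleton ℝ _ ℝ (0 : Fin 1)
    (z.2 ∘L mfderiv (cotangentModel E) 𝓘(ℝ, E) (TotalSpace.proj : Cotangent E Q → Q) z)

variable (E Q) in
/-- The canonical 2-form `Ω_Q = -dθ` on `T*Q`. -/
def canonicalForm : DiffForm (cotangentModel E) (Cotangent E Q) 2 := -(liouvilleForm E Q).d

variable (κ : KineticMetric E Q) (D : RegularDistribution 𝓘(ℝ, E) Q r)

/-- The constraint submanifold `M = Leg (D) ⊆ T*Q`, with its structure of a vector subbundle. -/
abbrev ConstraintManifold : Type _ := TotalSpace (Fin r → ℝ) (LegFiber κ D)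

variable (E r) in
/-- The model with corners of the constraint submanifold. -/
abbrev constraintModel := 𝓘(ℝ, E).prod 𝓘(ℝ, Fin r → ℝ)

/-- The natural inclusion `ι : M → T*Q`. -/
def inclusion (m : ConstraintManifold κ D) : Cotangent E Q := ⟨m.1, m.2.1⟩

/-- The 2-form `Ω_M = ι^* Ω_Q` on `M`. -/
def constraintForm : DiffForm (constraintModel E r) (ConstraintManifold κ D) 2 :=
  (canonicalForm E Q).pullback (inclusion κ D)

/-- The constraint distribution `C_m = {v ∈ T_m M : Tτ v ∈ D_{τ(m)}}`, with `τ : M → Q` the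
projection. -/
def constraintDistribution (m : ConstraintManifold κ D) :
    Submodule ℝ (TangentSpace (constraintModel E r) m) :=
  (D.fiber m.1).comap (mfderiv (constraintModel E r) 𝓘(ℝ, E)
    (TotalSpace.proj : ConstraintManifold κ D → Q) m : _ →ₗ[ℝ] TangentSpace 𝓘(ℝ, E) m.1)

/-- The nonholonomic bivector field `π_nh`. -/
def nonholonomicBivector : Bivector (constraintModel E r) (ConstraintManifold κ D) :=
  bivectorOfForm (constraintDistribution κ D) (constraintForm κ D)

end NonholonomicSystem

end Nonholonomic

end

open Nonholonomic
open scoped Manifold ContDiff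

noncomputable section

namespace Nonholonomic

open Bundle Set Function Filter VectorField
open scoped Topology

/-! ### Cartan calculus in a normed space, and the Jacobiator identity there. -/

section FlatCalculus

variable {V : Type*} [NormedAddCommGroup V] [NormedSpace ℝ V]

/-! On `C`, the gauge transformation by `B` replaces `Ω_M` by `Ω_M - B`: `π_B` takes values in `C`,
and `(Ω_M - B)(π_B α, v) = -α(v)` for `v ∈ C` (`IsGaugeTransform.form_eq`). Invertibility of `Id +
B^♭ ∘ π_nh^♯` makes `Ω_M - B` nondegenerate on `C` (`IsGaugeTransform.nondegenerate`). So it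
suffices to find the Jacobiator of the bivector field determined by an arbitrary, not necessarily
closed, 2-form `Ω` that is nondegenerate on a distribution `C` with complement `W`
(`schouten_eq_of_form`).

That is a computation with Cartan's formula (`jacobiator_eq`). Take covectors constant in a chart
and put `X_α = Λ α`, so that `Ω(X_α, X_β) = β(X_α)`. In `dΩ(X_α, X_β, X_γ)` the derivative terms add
up to the Jacobiator `J`. In the bracket terms, `[X_α, X_β]` is its `C`-part minus `K(α, β)`, where
`K(α, β)` abbreviates `K_W(X_α, X_β)`, and `Ω(·, X_γ)` agrees with `γ` on the `C`-part. Hence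
`Ω([X_α, X_β], X_γ) = γ([X_α, X_β]) + γ(K) - Ω(K, X_γ)`. Each `γ([X_α, X_β])` is a sum of two of the
three terms of `J`, so cyclically they give `2J`. Thus `dΩ = J - 2J + cycl.[Ω(K, X_γ) - γ(K)]`,
which is solved for `J`.

For `Ω = Ω_M - B`, closedness of `Ω_M` turns `-dΩ` into `dB`, and `B` drops out of the curvature
terms because `K` lies in `W`.

The remaining input is analytic. In a bundle chart of the constraint manifold, `Ω_M = -d(p dq)` with
`p` the momentum of the point (`constraintForm_inChart`). This gives differentiability, closedness
and, since the fibre coordinates are the values of `p` on a frame of `D`, nondegeneracy on `C`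
(`constraintForm_nondegenerate`). Frames of `C` and `W` give differentiability of the projection
onto `C` and of the fields `X_α`. -/

/-- A 2-form on a normed space as a continuous bilinear map, depending linearly on the form. -/
def bilinOfForm : (V [⋀^Fin 2]→L[ℝ] ℝ) →L[ℝ] V →L[ℝ] V →L[ℝ] ℝ :=
  (ContinuousLinearMap.compL ℝ V (V [⋀^Fin 1]→L[ℝ] ℝ) (V →L[ℝ] ℝ)
      ((ContinuousAlternatingMap.ofSubsingletonLIE (𝕜 := ℝ) (E := V) (F := ℝ)
        (0 : Fin 1)).symm.toContinuousLinearEquiv.toContinuousLinearMap)) ∘L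
    (ContinuousAlternatingMap.curryLeftLI).toContinuousLinearMap

theorem bilinOfForm_apply (η : V [⋀^Fin 2]→L[ℝ] ℝ) (v w : V) :
    bilinOfForm η v w = η ![v, w] := by
  change η (Matrix.vecCons v (fun _ ↦ w)) = _
  congr 1
  funext i
  fin_cases i <;> rfl

theorem two_form_swap (η : V [⋀^Fin 2]→L[ℝ] ℝ) (v w : V) : η ![v, w] = -η ![w, v] := by
  have h := η.map_swap ![w, v] (i := 0) (j := 1) (by decide)
  refine (congrArg η ?_).trans h
  funext i
  fin_cases i <;> rfl

theorem _root_.DifferentiableAt.bilinOfForm {G : Type*} [NormedAddCommGroup G] [NormedSpace ℝ G]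
    {η : G → V [⋀^Fin 2]→L[ℝ] ℝ} {x : G} (h : DifferentiableAt ℝ η x) :
    DifferentiableAt ℝ (fun y ↦ Nonholonomic.bilinOfForm (η y)) x :=
  DifferentiableAt.comp (g := fun a ↦ Nonholonomic.bilinOfForm a) x
    (ContinuousLinearMap.differentiableAt _) h

/-- The part of the bracket of two sections of the range of a field of projections `P` that is
transverse to this range depends only on the values of the sections at the point. -/
theorem sub_proj_lieBracket {P : V → V →L[ℝ] V} {X Y : V → V} {x : V}
    (hP : DifferentiableAt ℝ P x) (hX : DifferentiableAt ℝ X x) (hY : DifferentiableAt ℝ Y x)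
    (hPP : ∀ v, P x (P x v) = P x v) :
    lieBracket ℝ (fun y ↦ P y (X y)) (fun y ↦ P y (Y y)) x -
        P x (lieBracket ℝ (fun y ↦ P y (X y)) (fun y ↦ P y (Y y)) x) =
      (fderiv ℝ P x (P x (X x)) (Y x) - fderiv ℝ P x (P x (Y x)) (X x)) -
        P x (fderiv ℝ P x (P x (X x)) (Y x) - fderiv ℝ P x (P x (Y x)) (X x)) := by
  simp only [lieBracket, fderiv_clm_apply hP hX, fderiv_clm_apply hP hY]
  -- By the product rule, every term that differentiates `X` or `Y` has the form `P x (…)`;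
  -- idempotence of `P x` cancels these, leaving only derivatives of `P`.
  simp only [add_apply, ContinuousLinearMap.comp_apply,
    ContinuousLinearMap.flip_apply, map_add, map_sub, hPP]
  abel

/-- Cartan's formula, with the alternating signs absorbed by skew-symmetry of the form and of the
bracket, so that both groups of terms are cyclic sums as in the Jacobiator. -/
theorem extDeriv_two_form_apply {η : V → V [⋀^Fin 2]→L[ℝ] ℝ} {X Y Z : V → V} {x : V}
    (hη : DifferentiableAt ℝ η x) (hX : DifferentiableAt ℝ X x) (hY : DifferentiableAt ℝ Y x)
    (hZ : DifferentiableAt ℝ Z x) :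
    extDeriv η x ![X x, Y x, Z x] =
      fderiv ℝ (fun y ↦ η y ![Y y, Z y]) x (X x) + fderiv ℝ (fun y ↦ η y ![Z y, X y]) x (Y x) +
        fderiv ℝ (fun y ↦ η y ![X y, Y y]) x (Z x) -
      (η x ![lieBracket ℝ X Y x, Z x] + η x ![lieBracket ℝ Y Z x, X x] +
        η x ![lieBracket ℝ Z X x, Y x]) := by
  have h : extDeriv η x (fun i ↦ (![X, Y, Z] : Fin 3 → V → V) i x) =
      (∑ i : Fin 3, (-1) ^ i.val • fderiv ℝ (fun y ↦ η y (i.removeNth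
        (fun k ↦ (![X, Y, Z] : Fin 3 → V → V) k y))) x ((![X, Y, Z] : Fin 3 → V → V) i x)) -
      ∑ i : Fin 2, ∑ j ∈ Finset.Ici i, (-1) ^ (i + j : ℕ) •
        η x (Matrix.vecCons (lieBracket ℝ ((![X, Y, Z] : Fin 3 → V → V) i.castSucc)
            ((![X, Y, Z] : Fin 3 → V → V) j.succ) x)
          (j.removeNth <| i.castSucc.removeNth (fun k ↦ (![X, Y, Z] : Fin 3 → V → V) k x))) :=
    extDeriv_apply_vectorField (V := ![X, Y, Z]) hη (fun i ↦ by fin_cases i <;> assumption)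
  have hv : (fun i ↦ (![X, Y, Z] : Fin 3 → V → V) i x) = ![X x, Y x, Z x] := by
    funext i; fin_cases i <;> rfl
  have r0 : ∀ y, Fin.removeNth 0 (fun i ↦ (![X, Y, Z] : Fin 3 → V → V) i y) = ![Y y, Z y] :=
    fun y ↦ by funext i; fin_cases i <;> rfl
  have r1 : ∀ y, Fin.removeNth 1 (fun i ↦ (![X, Y, Z] : Fin 3 → V → V) i y) = ![X y, Z y] :=
    fun y ↦ by funext i; fin_cases i <;> rfl
  have r2 : ∀ y, Fin.removeNth 2 (fun i ↦ (![X, Y, Z] : Fin 3 → V → V) i y) = ![X y, Y y] :=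
    fun y ↦ by funext i; fin_cases i <;> rfl
  have s : ∀ a b : V, Fin.removeNth (0 : Fin 2) ![a, b] = ![b] := fun a b ↦ by
    funext i; fin_cases i; rfl
  have s' : ∀ a b : V, Fin.removeNth (1 : Fin 2) ![a, b] = ![a] := fun a b ↦ by
    funext i; fin_cases i; rfl
  rw [← hv, h]
  have hI0 : Finset.Ici (0 : Fin 2) = {0, 1} := by decide
  have hI1 : Finset.Ici (1 : Fin 2) = {1} := by decide
  have hneg : fderiv ℝ (fun y ↦ η y ![Z y, X y]) x = -fderiv ℝ (fun y ↦ η y ![X y, Z y]) x := by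
    rw [← fderiv_fun_neg]
    congr 1
    funext y
    exact two_form_swap _ _ _
  have hbr : η x ![lieBracket ℝ Z X x, Y x] = -η x ![lieBracket ℝ X Z x, Y x] := by
    rw [lieBracket_swap, ← bilinOfForm_apply, ← bilinOfForm_apply]
    simp
  simp only [Fin.sum_univ_three, Fin.sum_univ_two, hI0, hI1, r0, r1, r2, Fin.castSucc_zero,
    Fin.castSucc_one]
  rw [Finset.sum_pair (by decide), Finset.sum_singleton]
  simp [s, s', hneg, hbr]
  ring

/-- The Jacobiator of the bivector field `Λ` determined by a 2-form `Ω` on the range of a field of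
projections, evaluated on constant covectors. -/
theorem jacobiator_eq {Ω : V → V [⋀^Fin 2]→L[ℝ] ℝ} {Λ : V → (V →L[ℝ] ℝ) → V} {x : V}
    (P : V →L[ℝ] V) (hΩ : DifferentiableAt ℝ Ω x)
    (hΛ : ∀ α, DifferentiableAt ℝ (fun y ↦ Λ y α) x)
    (hΛΛ : ∀ᶠ y in 𝓝 x, ∀ α β, Ω y ![Λ y α, Λ y β] = β (Λ y α))
    (hΛP : ∀ α v, Ω x ![Λ x α, P v] = -α (P v))
    {κ : (V →L[ℝ] ℝ) → (V →L[ℝ] ℝ) → V}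
    (hκ : ∀ α β, κ α β = -(lieBracket ℝ (fun y ↦ Λ y α) (fun y ↦ Λ y β) x -
      P (lieBracket ℝ (fun y ↦ Λ y α) (fun y ↦ Λ y β) x)))
    (α β γ : V →L[ℝ] ℝ) :
    fderiv ℝ (fun y ↦ γ (Λ y β)) x (Λ x α) + fderiv ℝ (fun y ↦ α (Λ y γ)) x (Λ x β) +
        fderiv ℝ (fun y ↦ β (Λ y α)) x (Λ x γ) =
      (Ω x ![κ α β, Λ x γ] - γ (κ α β)) + (Ω x ![κ β γ, Λ x α] - α (κ β γ)) +
        (Ω x ![κ γ α, Λ x β] - β (κ γ α)) - extDeriv Ω x ![Λ x α, Λ x β, Λ x γ] := by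
  have hd : ∀ a b c : V →L[ℝ] ℝ, fderiv ℝ (fun y ↦ Ω y ![Λ y b, Λ y c]) x (Λ x a) =
      fderiv ℝ (fun y ↦ c (Λ y b)) x (Λ x a) := by
    intro a b c
    rw [Filter.EventuallyEq.fderiv_eq (f₁ := fun y ↦ Ω y ![Λ y b, Λ y c])
      (f := fun y ↦ c (Λ y b)) (hΛΛ.mono fun y hy ↦ hy b c)]
  have hc : ∀ a b c : V →L[ℝ] ℝ, fderiv ℝ (fun y ↦ c (Λ y b)) x (Λ x a) =
      c (fderiv ℝ (fun y ↦ Λ y b) x (Λ x a)) := by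
    intro a b c
    have := (c.hasFDerivAt.comp x (hΛ b).hasFDerivAt).fderiv
    exact congrArg (fun L ↦ L (Λ x a)) this
  have hskew : ∀ a b c : V →L[ℝ] ℝ, fderiv ℝ (fun y ↦ c (Λ y b)) x (Λ x a) =
      -fderiv ℝ (fun y ↦ b (Λ y c)) x (Λ x a) := by
    intro a b c
    rw [← hd, ← hd, ← neg_apply, ← fderiv_fun_neg]
    simp_rw [two_form_swap _ (Λ _ b) (Λ _ c)]
  -- The bracket is its `P`-part minus `κ a b`. Against `Λ x c` the form is known only on the
  -- `P`-part, where it equals `c`. Since `c` is constant, `c` of the bracket is a difference of two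
  -- derivatives, and `hskew` gives the second the sign it has in the Jacobiator.
  have hb : ∀ a b c : V →L[ℝ] ℝ,
      Ω x ![lieBracket ℝ (fun y ↦ Λ y a) (fun y ↦ Λ y b) x, Λ x c] =
        fderiv ℝ (fun y ↦ c (Λ y b)) x (Λ x a) + fderiv ℝ (fun y ↦ a (Λ y c)) x (Λ x b) +
          c (κ a b) - Ω x ![κ a b, Λ x c] := by
    intro a b c
    set L := lieBracket ℝ (fun y ↦ Λ y a) (fun y ↦ Λ y b) x with hL
    have h1 : L = P L - κ a b := by rw [hκ]; abel
    have h2 : Ω x ![P L, Λ x c] = c (P L) := by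
      rw [two_form_swap, hΛP, neg_neg]
    have h3 : c (P L) = c L + c (κ a b) := by rw [← map_add]; congr 1; rw [hκ]; abel
    have h4 : c L = fderiv ℝ (fun y ↦ c (Λ y b)) x (Λ x a) +
        fderiv ℝ (fun y ↦ a (Λ y c)) x (Λ x b) := by
      rw [hskew b c a, hc, hc, hL, lieBracket, map_sub, sub_eq_add_neg]
    have h5 : Ω x ![L, Λ x c] = Ω x ![P L, Λ x c] - Ω x ![κ a b, Λ x c] := by
      conv_lhs => rw [h1]
      simp only [← bilinOfForm_apply, map_sub, sub_apply]
    rw [h5, h2, h3, h4]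
  rw [extDeriv_two_form_apply hΩ (hΛ α) (hΛ β) (hΛ γ), hd, hd, hd, hb, hb, hb]
  ring

end FlatCalculus

/-! ### Differentiability of fields defined implicitly through frames. -/

section Differentiability

variable {V K L : Type*} [NormedAddCommGroup V] [NormedSpace ℝ V]
  [NormedAddCommGroup K] [NormedSpace ℝ K] [NormedAddCommGroup L] [NormedSpace ℝ L]

theorem differentiableAt_inverse_of_isInvertible [CompleteSpace K] {A : V → K →L[ℝ] L} {x : V}
    (hA : DifferentiableAt ℝ A x) (hx : (A x).IsInvertible) :
    DifferentiableAt ℝ (fun y ↦ (A y).inverse) x :=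
  ((hx.contDiffAt_map_inverse (n := 1)).differentiableAt one_ne_zero).comp x hA

theorem eventually_isInvertible {V : Type*} [TopologicalSpace V] [CompleteSpace K]
    {A : V → K →L[ℝ] L} {x : V}
    (hA : ContinuousAt A x) (hx : (A x).IsInvertible) :
    ∀ᶠ y in 𝓝 x, (A y).IsInvertible := by
  obtain ⟨e, he⟩ := hx
  have := ContinuousLinearEquiv.nhds e
  rw [he] at this
  exact hA this

set_option synthInstance.maxHeartbeats 200000 in
/-- The section of the range of `J` determined by a covector and a 2-form that is nondegenerate on
the range of `J` is differentiable. -/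
theorem differentiableAt_of_form_eq [FiniteDimensional ℝ K]
    {Ω : V → V [⋀^Fin 2]→L[ℝ] ℝ} {J : V → K →L[ℝ] V} {X : V → V} {x : V} (α : V →L[ℝ] ℝ)
    (hΩ : DifferentiableAt ℝ Ω x) (hJ : DifferentiableAt ℝ J x)
    (hnd : ∀ c, (∀ c', Ω x ![J x c, J x c'] = 0) → c = 0)
    (hX : ∀ᶠ y in 𝓝 x, ∃ c, X y = J y c)
    (hα : ∀ᶠ y in 𝓝 x, ∀ c, Ω y ![X y, J y c] = -α (J y c)) :
    DifferentiableAt ℝ X x := by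
  have : CompleteSpace K := FiniteDimensional.complete ℝ K
  -- `N y` is the matrix of `Ω y` in the frame `J y`. It is invertible near `x`, so the coefficients
  -- of `X` solve a linear system with differentiable data: `X = J N⁻¹ (-α ∘ J)`.
  let N : V → K →L[ℝ] K →L[ℝ] ℝ := fun y ↦
    ((ContinuousLinearMap.compL ℝ K V ℝ).flip (J y)) ∘L bilinOfForm (Ω y) ∘L J y
  have hNa : ∀ y c c', N y c c' = Ω y ![J y c, J y c'] := fun y c c' ↦ by
    simp [N, bilinOfForm_apply]
  have hN : DifferentiableAt ℝ N x := by
    have h1 : DifferentiableAt ℝ (fun y ↦ bilinOfForm (Ω y)) x := hΩ.bilinOfForm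
    have h2 : DifferentiableAt ℝ (fun y ↦ (ContinuousLinearMap.compL ℝ K V ℝ).flip (J y)) x :=
      DifferentiableAt.comp (g := fun a ↦ (ContinuousLinearMap.compL ℝ K V ℝ).flip a) x
        (ContinuousLinearMap.differentiableAt _) hJ
    exact h2.clm_comp (h1.clm_comp hJ)
  have hinv : (N x).IsInvertible := by
    have hinj : Injective (N x : K →ₗ[ℝ] K →L[ℝ] ℝ) := by
      rw [injective_iff_map_eq_zero]
      intro c hc
      refine hnd c fun c' ↦ ?_
      rw [← hNa]
      exact congrArg (fun L : K →L[ℝ] ℝ ↦ L c') hc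
    have hfr : Module.finrank ℝ K = Module.finrank ℝ (K →L[ℝ] ℝ) := by
      rw [← (LinearMap.toContinuousLinearMap (𝕜 := ℝ) (E := K) (F' := ℝ)).finrank_eq]
      exact (Subspace.dual_finrank_eq).symm
    exact ⟨(LinearEquiv.ofInjectiveOfFinrankEq _ hinj hfr).toContinuousLinearEquiv, by ext; rfl⟩
  have hev : X =ᶠ[𝓝 x] fun y ↦ J y ((N y).inverse (-(α ∘L J y))) := by
    filter_upwards [hX, hα, eventually_isInvertible hN.continuousAt hinv] with y ⟨c, hc⟩ h2 ⟨e, he⟩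
    rw [hc]
    congr 1
    have : N y c = -(α ∘L J y) := by
      ext c'
      rw [hNa, ← hc, h2]
      rfl
    rw [← this, ← he]
    simp
  refine DifferentiableAt.congr_of_eventuallyEq ?_ hev
  refine hJ.clm_apply ((differentiableAt_inverse_of_isInvertible hN hinv).clm_apply ?_)
  exact ((differentiableAt_const α).clm_comp hJ).neg

/-- A field of projections with differentiable range and kernel is differentiable. -/
theorem differentiableAt_projection [FiniteDimensional ℝ K] [FiniteDimensional ℝ L]
    {J : V → K →L[ℝ] V} {S : V → L →L[ℝ] V} {P : V → V →L[ℝ] V} {x : V}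
    (hJ : DifferentiableAt ℝ J x) (hS : DifferentiableAt ℝ S x)
    (hbij : Bijective fun c : K × L ↦ J x c.1 + S x c.2)
    (hPJ : ∀ᶠ y in 𝓝 x, ∀ c, P y (J y c) = J y c) (hPS : ∀ᶠ y in 𝓝 x, ∀ c, P y (S y c) = 0) :
    DifferentiableAt ℝ P x := by
  have : CompleteSpace (K × L) := FiniteDimensional.complete ℝ _
  -- The two frames together form an isomorphism near `x`, in terms of which the projection is `J ∘
  -- fst ∘ A⁻¹`.
  let A : V → (K × L) →L[ℝ] V := fun y ↦
    (J y) ∘L (ContinuousLinearMap.fst ℝ K L) + (S y) ∘L (ContinuousLinearMap.snd ℝ K L)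
  have hA : DifferentiableAt ℝ A x :=
    (hJ.clm_comp (differentiableAt_const _)).add (hS.clm_comp (differentiableAt_const _))
  have hinv : (A x).IsInvertible := by
    let e := LinearEquiv.ofBijective (A x : K × L →ₗ[ℝ] V) hbij
    have : FiniteDimensional ℝ V := e.finiteDimensional
    exact ⟨e.toContinuousLinearEquiv, by ext <;> rfl⟩
  have hev : P =ᶠ[𝓝 x] fun y ↦ J y ∘L (ContinuousLinearMap.fst ℝ K L) ∘L (A y).inverse := by
    filter_upwards [hPJ, hPS, eventually_isInvertible hA.continuousAt hinv] with y h1 h2 ⟨e, he⟩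
    ext v
    obtain ⟨c, rfl⟩ := e.surjective v
    have hc : e c = J y c.1 + S y c.2 := by
      rw [← ContinuousLinearEquiv.coe_coe, he]; rfl
    rw [← he]
    conv_lhs => rw [hc]
    simp [h1, h2]
  refine DifferentiableAt.congr_of_eventuallyEq ?_ hev
  exact hJ.clm_comp ((differentiableAt_const _).clm_comp
    (differentiableAt_inverse_of_isInvertible hA hinv))

end Differentiability

/-! ### Forms, vector fields, brackets and projections read in a chart. -/

section Charts

variable {E : Type*} [NormedAddCommGroup E] [NormedSpace ℝ E] {H : Type*} [TopologicalSpace H]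
  {I : ModelWithCorners ℝ E H} {M : Type*} [TopologicalSpace M] [ChartedSpace H M]

/-- Identities between fibrewise objects are checked at points `z` of the manifold and transported
to the model space by this; without boundary, the chart target is a neighbourhood of the image of
`x`. -/
theorem eventually_nhds_extChartAt [I.Boundaryless] {x : M} {p : E → Prop}
    (h : ∀ᶠ z in 𝓝 x, p (extChartAt I x z)) : ∀ᶠ y in 𝓝 (extChartAt I x x), p y := by
  have h1 : Tendsto (extChartAt I x).symm (𝓝 (extChartAt I x x)) (𝓝 x) := by
    have := continuousAt_extChartAt_symm (I := I) x
    rwa [ContinuousAt, extChartAt_to_inv] at this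
  filter_upwards [h1.eventually h, extChartAt_target_mem_nhds (I := I) x] with y hy hy'
  rwa [(extChartAt I x).right_inv hy'] at hy

variable [IsManifold I ∞ M]

theorem isManifold_one_of_smooth : IsManifold I 1 M := IsManifold.of_le (n := ∞) (by simp)

attribute [local instance] isManifold_one_of_smooth

variable (I) in
/-- The derivative at `z` of the chart at `x`. -/
def chartDeriv (x z : M) : TangentSpace I z →L[ℝ] E :=
  (trivializationAt E (TangentSpace I) x).continuousLinearMapAt ℝ z

variable (I) in
/-- The inverse of the derivative at `z` of the chart at `x`. -/
def chartDerivSymm (x z : M) : E →L[ℝ] TangentSpace I z :=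
  (trivializationAt E (TangentSpace I) x).symmL ℝ z

theorem chartDeriv_symm {x z : M} (hz : z ∈ (extChartAt I x).source) (u : E) :
    chartDeriv I x z (chartDerivSymm I x z u) = u :=
  Trivialization.continuousLinearMapAt_symmL _ (by simpa using hz) u

theorem chartDerivSymm_apply {x z : M} (hz : z ∈ (extChartAt I x).source) (u : TangentSpace I z) :
    chartDerivSymm I x z (chartDeriv I x z u) = u :=
  Trivialization.symmL_continuousLinearMapAt _ (by simpa using hz) u

theorem chartDeriv_self (x : M) (v : TangentSpace I x) : chartDeriv I x x v = v := by
  have h := TangentBundle.continuousLinearMapAt_trivializationAt (I := I) (mem_chart_source H x)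
  have h' := mfderiv_extChartAt_self (I := I) (x := x)
  exact (congrArg (fun L : E →L[ℝ] E ↦ L v) h).trans (congrArg (fun L : E →L[ℝ] E ↦ L v) h')

/-- Smoothness of vector fields is expressed by the trivializations of the tangent bundle, forms and
brackets by derivatives of charts. This lemma and the next one reconcile the two descriptions. -/
theorem mfderiv_extChartAt_eq {x z : M} (hz : z ∈ (extChartAt I x).source) :
    (mfderiv I 𝓘(ℝ, E) (extChartAt I x) z : TangentSpace I z →L[ℝ] E) = chartDeriv I x z :=
  (TangentBundle.continuousLinearMapAt_trivializationAt (I := I) (by simpa using hz)).symm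

theorem mfderiv_extChartAt_symm_eq [I.Boundaryless] {x : M} {y : E}
    (hy : y ∈ (extChartAt I x).target) :
    (mfderiv 𝓘(ℝ, E) I (extChartAt I x).symm y :
      E →L[ℝ] TangentSpace I ((extChartAt I x).symm y)) =
      chartDerivSymm I x ((extChartAt I x).symm y) := by
  have hz : (extChartAt I x).symm y ∈ (chartAt H x).source := by
    simpa using (extChartAt I x).map_target hy
  have h := TangentBundle.symmL_trivializationAt (I := I) (x₀ := x) hz
  have h' := congrArg (fun w : E ↦ (show E →L[ℝ] E from
    mfderivWithin 𝓘(ℝ, E) I (extChartAt I x).symm (range I) w)) ((extChartAt I x).right_inv hy)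
  have h'' : (mfderivWithin 𝓘(ℝ, E) I (extChartAt I x).symm (range I) y) =
      (mfderiv 𝓘(ℝ, E) I (extChartAt I x).symm y) := by
    rw [I.range_eq_univ, mfderivWithin_univ]
  exact (h.trans (h'.trans h'')).symm

theorem DiffForm.inChart_extChartAt [I.Boundaryless] {k : ℕ} (η : DiffForm I M k) {x z : M}
    (hz : z ∈ (extChartAt I x).source) (v : Fin k → TangentSpace I z) :
    η.inChart x (extChartAt I x z) (fun i ↦ chartDeriv I x z (v i)) = η z v := by
  have hy := (extChartAt I x).map_source hz
  have h1 : η.inChart x (extChartAt I x z) (fun i ↦ chartDeriv I x z (v i)) =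
      η ((extChartAt I x).symm (extChartAt I x z)) (fun i ↦
        (mfderiv 𝓘(ℝ, E) I (extChartAt I x).symm (extChartAt I x z) :
          E →L[ℝ] TangentSpace I ((extChartAt I x).symm (extChartAt I x z)))
          (chartDeriv I x z (v i))) := rfl
  rw [h1, mfderiv_extChartAt_symm_eq hy]
  -- The tangent space depends on the base point, so the round trip through the chart is treated as
  -- a variable `z'` and removed by substitution.
  have key : ∀ z', z' = z → η z' (fun i ↦ chartDerivSymm I x z' (chartDeriv I x z (v i))) =
      η z v := by
    rintro _ rfl
    simp only [chartDerivSymm_apply hz]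
  exact key _ ((extChartAt I x).left_inv hz)

theorem DiffForm.inChart_two_apply [I.Boundaryless] (η : DiffForm I M 2) {x z : M}
    (hz : z ∈ (extChartAt I x).source) (u v : TangentSpace I z) :
    η.inChart x (extChartAt I x z) ![chartDeriv I x z u, chartDeriv I x z v] = η z ![u, v] := by
  rw [← η.inChart_extChartAt hz]
  congr 1
  funext i
  fin_cases i <;> rfl

theorem DiffForm.inChart_two_self [I.Boundaryless] (η : DiffForm I M 2) (x : M)
    (u v : TangentSpace I x) :
    η.inChart x (extChartAt I x x) ![u, v] = η x ![u, v] := by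
  rw [← η.inChart_two_apply (mem_extChartAt_source x), chartDeriv_self, chartDeriv_self]

/-- The preferred chart at `x` has the identity as derivative at its own centre, so no pullback is
left. -/
theorem DiffForm.d_apply {k : ℕ} (η : DiffForm I M k) (x : M)
    (v : Fin (k + 1) → TangentSpace I x) :
    η.d x v = extDeriv (η.inChart x) (extChartAt I x x) v := by
  have h : (mfderiv I 𝓘(ℝ, E) (extChartAt I x) x : E →L[ℝ] E) = ContinuousLinearMap.id ℝ E :=
    mfderiv_extChartAt_self (I := I) (x := x)
  change extDeriv (η.inChart x) (extChartAt I x x)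
    (fun i ↦ (mfderiv I 𝓘(ℝ, E) (extChartAt I x) x : E →L[ℝ] E) (v i)) = _
  rw [h]
  rfl

/-- The vector field `X` in the chart at `x`. -/
def fieldInChart (x : M) (X : ∀ z : M, TangentSpace I z) (y : E) : E :=
  (fun z ↦ chartDeriv I x z (X z)) ((extChartAt I x).symm y)

theorem fieldInChart_apply {x z : M} (hz : z ∈ (extChartAt I x).source)
    (X : ∀ z : M, TangentSpace I z) :
    fieldInChart x X (extChartAt I x z) = chartDeriv I x z (X z) :=
  congrArg (fun z ↦ chartDeriv I x z (X z)) ((extChartAt I x).left_inv hz)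

theorem fieldInChart_self (x : M) (X : ∀ z : M, TangentSpace I z) :
    fieldInChart x X (extChartAt I x x) = X x :=
  (fieldInChart_apply (mem_extChartAt_source x) X).trans (chartDeriv_self x _)

theorem mpullbackWithin_extChartAt_symm_eq [I.Boundaryless] {x : M} {y : E}
    (hy : y ∈ (extChartAt I x).target) (X : ∀ z : M, TangentSpace I z) :
    (mpullbackWithin 𝓘(ℝ, E) I (extChartAt I x).symm X (range I) y : E) = fieldInChart x X y := by
  have hz := (extChartAt I x).map_target hy
  have h := mfderiv_extChartAt_symm_eq (I := I) hy
  have hinv : (chartDerivSymm I x ((extChartAt I x).symm y)).inverse =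
      chartDeriv I x ((extChartAt I x).symm y) := by
    apply ContinuousLinearMap.inverse_eq
    · ext u; exact chartDerivSymm_apply hz u
    · ext u; exact chartDeriv_symm hz u
  have h0 : (mpullbackWithin 𝓘(ℝ, E) I (extChartAt I x).symm X (range I) y : E) =
      ((mfderiv 𝓘(ℝ, E) I (extChartAt I x).symm y : E →L[ℝ] _)).inverse
        (X ((extChartAt I x).symm y)) := by
    rw [mpullbackWithin_apply, I.range_eq_univ, mfderivWithin_univ]
  exact h0.trans ((congrArg (fun L : E →L[ℝ] TangentSpace I ((extChartAt I x).symm y) ↦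
    L.inverse (X ((extChartAt I x).symm y))) h).trans
      (congrArg (fun L : TangentSpace I ((extChartAt I x).symm y) →L[ℝ] E ↦
        L (X ((extChartAt I x).symm y))) hinv))

/-- The bracket on a manifold is the bracket of the fields pulled back by the inverse chart,
returned by the inverse derivative of the chart. At the centre this derivative is the identity. -/
theorem mlieBracket_eq_lieBracket [I.Boundaryless] (x : M) (X Y : ∀ z : M, TangentSpace I z) :
    mlieBracket I X Y x =
      lieBracket ℝ (fieldInChart x X) (fieldInChart x Y) (extChartAt I x x) := by
  have h1 := fun X : ∀ z : M, TangentSpace I z ↦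
    Filter.eventually_of_mem (extChartAt_target_mem_nhds (I := I) x)
      fun y hy ↦ mpullbackWithin_extChartAt_symm_eq hy X
  have h := mlieBracketWithin_apply (I := I) (V := X) (W := Y) (s := univ) (x₀ := x)
  rw [mlieBracketWithin_univ] at h
  have h2 : (lieBracketWithin ℝ (mpullbackWithin 𝓘(ℝ, E) I (extChartAt I x).symm X (range I))
      (mpullbackWithin 𝓘(ℝ, E) I (extChartAt I x).symm Y (range I))
      ((extChartAt I x).symm ⁻¹' univ ∩ range I) (extChartAt I x x) : E) =
      lieBracket ℝ (fieldInChart x X) (fieldInChart x Y) (extChartAt I x x) := by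
    have hs : (extChartAt I x).symm ⁻¹' univ ∩ range I = univ := by simp [I.range_eq_univ]
    rw [hs]
    exact (congrFun lieBracketWithin_univ _).trans
      (Filter.EventuallyEq.lieBracket_vectorField_eq (h1 X) (h1 Y))
  have hid : (mfderiv I 𝓘(ℝ, E) (extChartAt I x) x : E →L[ℝ] E) = ContinuousLinearMap.id ℝ E :=
    mfderiv_extChartAt_self (I := I) (x := x)
  have h3 : ∀ u : E, (mfderiv I 𝓘(ℝ, E) (extChartAt I x) x : E →L[ℝ] E).inverse u = u := by
    intro u
    exact (congrArg (fun L : E →L[ℝ] E ↦ L.inverse u) hid).trans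
      (congrArg (fun L : E →L[ℝ] E ↦ L u) ContinuousLinearMap.inverse_id)
  exact h.trans ((h3 _).trans h2)

theorem contDiffAt_fieldInChart [I.Boundaryless] {n : WithTop ℕ∞} (hn : n ≤ ∞) {x : M}
    {X : ∀ z : M, TangentSpace I z}
    (hX : ContMDiffAt I I.tangent n (fun z ↦ (⟨z, X z⟩ : TangentBundle I M)) x) :
    ContDiffAt ℝ n (fieldInChart x X) (extChartAt I x x) := by
  have h1 : ContMDiffAt I 𝓘(ℝ, E) n (fun z ↦ chartDeriv I x z (X z)) x := by
    refine ((contMDiffAt_totalSpace.1 hX).2).congr_of_eventuallyEq ?_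
    filter_upwards [(isOpen_extChartAt_source (I := I) x).mem_nhds (mem_extChartAt_source x)]
      with z hz
    exact Trivialization.continuousLinearMapAt_apply_of_mem _ _ (by simpa using hz) _
  have h2 : ContMDiffAt 𝓘(ℝ, E) I n (extChartAt I x).symm (extChartAt I x x) := by
    have := IsManifold.of_le (I := I) (M := M) hn
    have := contMDiffWithinAt_extChartAt_symm_range_self (I := I) (n := n) x
    rwa [I.range_eq_univ, contMDiffWithinAt_univ] at this
  exact (ContMDiffAt.comp_of_eq h1 h2 (extChartAt_to_inv x)).contDiffAt

variable [FiniteDimensional ℝ E] {C W : ∀ x : M, Submodule ℝ (TangentSpace I x)}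

/-- The projection onto `C` along `W` in the chart at `x`. -/
def projInChart (h : ∀ x, IsCompl (C x) (W x)) (x : M) (y : E) : E →L[ℝ] E :=
  (fun z : M ↦ LinearMap.toContinuousLinearMap ((chartDeriv I x z : TangentSpace I z →ₗ[ℝ] E) ∘ₗ
    (C z).projection (W z) (h z) ∘ₗ (chartDerivSymm I x z : E →ₗ[ℝ] TangentSpace I z)))
      ((extChartAt I x).symm y)

theorem projInChart_apply (h : ∀ x, IsCompl (C x) (W x)) {x z : M}
    (hz : z ∈ (extChartAt I x).source) (v : TangentSpace I z) :
    projInChart h x (extChartAt I x z) (chartDeriv I x z v) =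
      chartDeriv I x z ((C z).projection (W z) (h z) v) := by
  rw [projInChart, (extChartAt I x).left_inv hz]
  change chartDeriv I x z ((C z).projection (W z) (h z)
    (chartDerivSymm I x z (chartDeriv I x z v))) = _
  rw [chartDerivSymm_apply hz]

theorem projInChart_self (h : ∀ x, IsCompl (C x) (W x)) (x : M) (v : TangentSpace I x) :
    projInChart h x (extChartAt I x x) v = (C x).projection (W x) (h x) v := by
  have := projInChart_apply h (mem_extChartAt_source (I := I) x) v
  rwa [chartDeriv_self, chartDeriv_self] at this

theorem projInChart_projInChart (h : ∀ x, IsCompl (C x) (W x)) (x : M) (v : E) :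
    projInChart h x (extChartAt I x x) (projInChart h x (extChartAt I x x) v) =
      projInChart h x (extChartAt I x x) v := by
  have h1 := projInChart_self h x v
  have h2 := projInChart_self h x ((C x).projection (W x) (h x) v)
  have h3 : (C x).projection (W x) (h x) ((C x).projection (W x) (h x) v) =
    (C x).projection (W x) (h x) v :=
    Submodule.projection_apply_of_mem_left _ (Submodule.projection_apply_mem _ _)
  rw [h1, h2, h3]

/-- Since `P_W = Id - P_C`, the curvature is expressed through the projection onto `C` alone, in the
shape that `sub_proj_lieBracket` and `jacobiator_eq` handle. -/
theorem curvatureField_eq_lieBracket [I.Boundaryless] (h : ∀ x, IsCompl (C x) (W x))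
    (X Y : ∀ z : M, TangentSpace I z) (x : M) :
    curvatureField h X Y x =
      -(lieBracket ℝ (fun y ↦ projInChart h x y (fieldInChart x X y))
          (fun y ↦ projInChart h x y (fieldInChart x Y y)) (extChartAt I x x) -
        projInChart h x (extChartAt I x x)
          (lieBracket ℝ (fun y ↦ projInChart h x y (fieldInChart x X y))
            (fun y ↦ projInChart h x y (fieldInChart x Y y)) (extChartAt I x x))) := by
  have hX : ∀ X : ∀ z : M, TangentSpace I z,
      fieldInChart x (fun z ↦ (C z).projection (W z) (h z) (X z)) =ᶠ[𝓝 (extChartAt I x x)]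
        fun y ↦ projInChart h x y (fieldInChart x X y) := by
    intro X
    refine eventually_nhds_extChartAt ?_
    filter_upwards [(isOpen_extChartAt_source (I := I) x).mem_nhds (mem_extChartAt_source x)]
      with z hz
    rw [fieldInChart_apply hz, fieldInChart_apply hz, projInChart_apply h hz]
  rw [← Filter.EventuallyEq.lieBracket_vectorField_eq (hX X) (hX Y)]
  have hP : ∀ v : TangentSpace I x, (W x).projection (C x) (h x).symm v =
      v - (C x).projection (W x) (h x) v := fun v ↦
    Submodule.projection_eq_self_sub_projection (h x) v
  rw [curvatureField, hP, ← projInChart_self]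
  exact congrArg (fun v : E ↦ -(v - projInChart h x (extChartAt I x x) v))
    (mlieBracket_eq_lieBracket x _ _)

/-- `K_W` is tensorial. -/
theorem curvatureField_eq [I.Boundaryless] (h : ∀ x, IsCompl (C x) (W x))
    {X Y : ∀ z : M, TangentSpace I z} {x : M}
    (hP : DifferentiableAt ℝ (projInChart h x) (extChartAt I x x))
    (hX : DifferentiableAt ℝ (fieldInChart x X) (extChartAt I x x))
    (hY : DifferentiableAt ℝ (fieldInChart x Y) (extChartAt I x x)) :
    curvatureField h X Y x =
      -((fderiv ℝ (projInChart h x) (extChartAt I x x)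
            (projInChart h x (extChartAt I x x) (X x)) (Y x) -
          fderiv ℝ (projInChart h x) (extChartAt I x x)
            (projInChart h x (extChartAt I x x) (Y x)) (X x)) -
        projInChart h x (extChartAt I x x)
          (fderiv ℝ (projInChart h x) (extChartAt I x x)
            (projInChart h x (extChartAt I x x) (X x)) (Y x) -
          fderiv ℝ (projInChart h x) (extChartAt I x x)
            (projInChart h x (extChartAt I x x) (Y x)) (X x))) := by
  rw [curvatureField_eq_lieBracket, sub_proj_lieBracket hP hX hY (projInChart_projInChart h x)]
  have hX' := fieldInChart_self x X
  have hY' := fieldInChart_self x Y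
  rw [hX', hY']

end Charts

/-! ### The Jacobiator of the bivector field of a 2-form on a distribution. -/

section Jacobiator

variable {E : Type*} [NormedAddCommGroup E] [NormedSpace ℝ E] {H : Type*} [TopologicalSpace H]
  {I : ModelWithCorners ℝ E H} {M : Type*} [TopologicalSpace M] [ChartedSpace H M]
  [IsManifold I ∞ M]

attribute [local instance] isManifold_one_of_smooth

/-- `J` is a differentiable frame of the family `C` of subspaces of the tangent spaces, in the chart
at `x`. -/
structure IsFrameInChart {K : Type*} [NormedAddCommGroup K] [NormedSpace ℝ K]
    (C : ∀ x : M, Submodule ℝ (TangentSpace I x)) (x : M) (J : E → K →L[ℝ] E) : Prop where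
  differentiableAt : DifferentiableAt ℝ J (extChartAt I x x)
  mem_iff : ∀ᶠ z in 𝓝 x, ∀ v, v ∈ C z ↔ ∃ c, chartDeriv I x z v = J (extChartAt I x z) c
  injective : Injective (J (extChartAt I x x))

variable {C W : ∀ x : M, Submodule ℝ (TangentSpace I x)} {x : M}
  {K L : Type*} [NormedAddCommGroup K] [NormedSpace ℝ K]
  [NormedAddCommGroup L] [NormedSpace ℝ L]
  {J : E → K →L[ℝ] E} {S : E → L →L[ℝ] E}

theorem IsFrameInChart.mem_iff_self (hJ : IsFrameInChart C x J) (v : TangentSpace I x) :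
    v ∈ C x ↔ ∃ c, J (extChartAt I x x) c = v := by
  rw [hJ.mem_iff.self_of_nhds v, chartDeriv_self]
  exact ⟨fun ⟨c, hc⟩ ↦ ⟨c, hc.symm⟩, fun ⟨c, hc⟩ ↦ ⟨c, hc.symm⟩⟩

theorem IsFrameInChart.exists_mem (hJ : IsFrameInChart C x J) :
    ∀ᶠ z in 𝓝 x, ∀ c, ∃ v ∈ C z, chartDeriv I x z v = J (extChartAt I x z) c := by
  filter_upwards [hJ.mem_iff,
    (isOpen_extChartAt_source (I := I) x).mem_nhds (mem_extChartAt_source x)] with z hz hzs c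
  exact ⟨chartDerivSymm I x z (J (extChartAt I x z) c),
    (hz _).2 ⟨c, chartDeriv_symm hzs _⟩, chartDeriv_symm hzs _⟩

variable [FiniteDimensional ℝ K] [FiniteDimensional ℝ L]

theorem differentiableAt_projInChart [FiniteDimensional ℝ E] [I.Boundaryless]
    (h : ∀ x, IsCompl (C x) (W x)) (hJ : IsFrameInChart C x J) (hS : IsFrameInChart W x S) :
    DifferentiableAt ℝ (projInChart h x) (extChartAt I x x) := by
  refine differentiableAt_projection hJ.differentiableAt hS.differentiableAt ⟨?_, ?_⟩
    (eventually_nhds_extChartAt ?_) (eventually_nhds_extChartAt ?_)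
  · rintro ⟨a, b⟩ ⟨a', b'⟩ hab
    have h1 : J (extChartAt I x x) (a - a') = S (extChartAt I x x) (b' - b) := by
      rw [map_sub, map_sub, sub_eq_sub_iff_add_eq_add]
      exact hab.trans (add_comm _ _)
    have h2 := (hJ.mem_iff_self _).2 ⟨a - a', rfl⟩
    have h3 := (hS.mem_iff_self _).2 ⟨b' - b, rfl⟩
    have h4 : J (extChartAt I x x) (a - a') = 0 :=
      Submodule.disjoint_def.1 (h x).disjoint
        (show TangentSpace I x from J (extChartAt I x x) (a - a')) h2 (by rw [h1]; exact h3)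
    have ha : a - a' = 0 := hJ.injective (h4.trans (map_zero (J (extChartAt I x x))).symm)
    have hb : b' - b = 0 :=
      hS.injective ((h1.symm.trans h4).trans (map_zero (S (extChartAt I x x))).symm)
    rw [sub_eq_zero.1 ha, sub_eq_zero.1 hb]
  · intro v
    have htop : ∀ u : TangentSpace I x, u ∈ C x ⊔ W x := fun u ↦ by
      rw [(h x).sup_eq_top]; trivial
    obtain ⟨u, hu, w, hw, huw⟩ := Submodule.mem_sup.1 (htop v)
    obtain ⟨a, ha⟩ := (hJ.mem_iff_self u).1 hu
    obtain ⟨b, hb⟩ := (hS.mem_iff_self w).1 hw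
    refine ⟨(a, b), ?_⟩
    rw [← huw, ← ha, ← hb]
    rfl
  · filter_upwards [hJ.exists_mem,
      (isOpen_extChartAt_source (I := I) x).mem_nhds (mem_extChartAt_source x)] with z hz hzs c
    obtain ⟨v, hv, hvc⟩ := hz c
    rw [← hvc, projInChart_apply h hzs, Submodule.projection_apply_of_mem_left _ hv]
  · filter_upwards [hS.exists_mem,
      (isOpen_extChartAt_source (I := I) x).mem_nhds (mem_extChartAt_source x)] with z hz hzs c
    obtain ⟨v, hv, hvc⟩ := hz c
    rw [← hvc, projInChart_apply h hzs, (Submodule.projection_apply_eq_zero_iff _).2 hv, map_zero]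

/-- The vector field `Λ^♯ α` in the chart at `x`, for a covector `α` that is constant in the
chart. -/
def Bivector.inChart (Λ : Bivector I M) (x : M) (y : E) (α : E →L[ℝ] ℝ) : E :=
  fieldInChart x (fun z ↦ Λ z (α ∘L chartDeriv I x z)) y

theorem mvfderiv_coordFun_of_mem {z : M} (hz : z ∈ (extChartAt I x).source)
    (a : TangentSpace I x →L[ℝ] ℝ) :
    mvfderiv I (coordFun x a) z = (show E →L[ℝ] ℝ from a) ∘L chartDeriv I x z := by
  rw [← mfderiv_extChartAt_eq hz]
  have h1 : MDifferentiableAt 𝓘(ℝ, E) 𝓘(ℝ, ℝ) (show E →L[ℝ] ℝ from a) (extChartAt I x z) :=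
    (show E →L[ℝ] ℝ from a).mdifferentiableAt
  have h2 : MDifferentiableAt I 𝓘(ℝ, E) (extChartAt I x) z :=
    mdifferentiableAt_extChartAt (by simpa using hz)
  have h3 := mfderiv_comp z h1 h2
  have h4 : mfderiv 𝓘(ℝ, E) 𝓘(ℝ, ℝ) (show E →L[ℝ] ℝ from a) (extChartAt I x z) =
      (show E →L[ℝ] ℝ from a) := (show E →L[ℝ] ℝ from a).mfderiv_eq
  rw [h4] at h3
  exact h3

theorem mvfderiv_comp_extChartAt {F : E → ℝ}
    (hF : DifferentiableAt ℝ F (extChartAt I x x)) (v : TangentSpace I x) :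
    mvfderiv I (fun z ↦ F (extChartAt I x z)) x v = fderiv ℝ F (extChartAt I x x) v := by
  have h1 : MDifferentiableAt 𝓘(ℝ, E) 𝓘(ℝ, ℝ) F (extChartAt I x x) := hF.mdifferentiableAt
  have h2 : MDifferentiableAt I 𝓘(ℝ, E) (extChartAt I x) x :=
    mdifferentiableAt_extChartAt (mem_chart_source H x)
  have h3 := mfderiv_comp x h1 h2
  rw [mfderiv_eq_fderiv] at h3
  have h4 : (mfderiv I 𝓘(ℝ, E) (extChartAt I x) x : E →L[ℝ] E) = ContinuousLinearMap.id ℝ E :=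
    mfderiv_extChartAt_self (I := I) (x := x)
  have h5 := congrArg (fun L : E →L[ℝ] ℝ ↦ L v) h3
  refine h5.trans ?_
  exact congrArg (fun L : E →L[ℝ] E ↦ fderiv ℝ F (extChartAt I x x) (L v)) h4

/-- The differentials of the coordinate functions are constant covectors throughout the chart, so
the inner bracket is `γ (Λ β)` near `x`, and the outer one is its derivative along `Λ α`. This links
the Schouten bracket to `jacobiator_eq`. -/
theorem bracket_bracket_coordFun [I.Boundaryless] {Λ : Bivector I M}
    (hΛ : ∀ α, DifferentiableAt ℝ (fun y ↦ Λ.inChart x y α) (extChartAt I x x))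
    (α β γ : TangentSpace I x →L[ℝ] ℝ) :
    Λ.bracket (coordFun x α) (Λ.bracket (coordFun x β) (coordFun x γ)) x =
      fderiv ℝ (fun y ↦ (show E →L[ℝ] ℝ from γ) (Λ.inChart x y β)) (extChartAt I x x)
        (Λ x α) := by
  have hev : Λ.bracket (coordFun x β) (coordFun x γ) =ᶠ[𝓝 x]
      fun z ↦ (fun y ↦ (show E →L[ℝ] ℝ from γ) (Λ.inChart x y β)) (extChartAt I x z) := by
    filter_upwards [(isOpen_extChartAt_source (I := I) x).mem_nhds (mem_extChartAt_source x)]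
      with z hz
    rw [Bivector.bracket, mvfderiv_coordFun_of_mem hz, mvfderiv_coordFun_of_mem hz]
    exact congrArg (show E →L[ℝ] ℝ from γ) (fieldInChart_apply hz
      (fun z ↦ Λ z ((show E →L[ℝ] ℝ from β) ∘L chartDeriv I x z))).symm
  have hd : DifferentiableAt ℝ (fun y ↦ (show E →L[ℝ] ℝ from γ) (Λ.inChart x y β))
      (extChartAt I x x) := (show E →L[ℝ] ℝ from γ).differentiableAt.comp _ (hΛ β)
  rw [← mvfderiv_comp_extChartAt hd, Bivector.bracket, mvfderiv_coordFun, mvfderiv, mvfderiv,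
    hev.mfderiv_eq]
  rfl

theorem Bivector.inChart_self (Λ : Bivector I M) (α : E →L[ℝ] ℝ) :
    Λ.inChart x (extChartAt I x x) α = Λ x (show TangentSpace I x →L[ℝ] ℝ from α) := by
  rw [Bivector.inChart, fieldInChart_self]
  congr 1
  ext v
  exact congrArg α (chartDeriv_self x v)

/-- The Jacobiator of the bivector field determined by a 2-form `Ω` that is nondegenerate on a
distribution `C` with complement `W`. -/
theorem schouten_eq_of_form [FiniteDimensional ℝ E] [I.Boundaryless]
    (h : ∀ x, IsCompl (C x) (W x)) (hJ : IsFrameInChart C x J) (hS : IsFrameInChart W x S)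
    {Ω : DiffForm I M 2} (hΩ : DifferentiableAt ℝ (Ω.inChart x) (extChartAt I x x))
    {Λ : Bivector I M} (hmem : ∀ z α, Λ z α ∈ C z)
    (hΛ : ∀ z α, ∀ v ∈ C z, Ω z ![Λ z α, v] = -α v)
    (hnd : ∀ u ∈ C x, (∀ v ∈ C x, Ω x ![u, v] = 0) → u = 0)
    (α β γ : TangentSpace I x →L[ℝ] ℝ) :
    1 / 2 * schouten Λ Λ x α β γ =
      (Ω x ![curvature h x (Λ x α) (Λ x β), Λ x γ] - γ (curvature h x (Λ x α) (Λ x β))) +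
      (Ω x ![curvature h x (Λ x β) (Λ x γ), Λ x α] - α (curvature h x (Λ x β) (Λ x γ))) +
      (Ω x ![curvature h x (Λ x γ) (Λ x α), Λ x β] - β (curvature h x (Λ x γ) (Λ x α))) -
      Ω.d x ![Λ x α, Λ x β, Λ x γ] := by
  have hsrc := (isOpen_extChartAt_source (I := I) x).mem_nhds (mem_extChartAt_source x)
  have hP := differentiableAt_projInChart h hJ hS
  have hd : ∀ a : E →L[ℝ] ℝ, DifferentiableAt ℝ (fun y ↦ Λ.inChart x y a) (extChartAt I x x) := by
    intro a
    refine differentiableAt_of_form_eq a hΩ hJ.differentiableAt ?_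
      (eventually_nhds_extChartAt ?_) (eventually_nhds_extChartAt ?_)
    · intro c hc
      refine hJ.injective ((hnd _ ((hJ.mem_iff_self _).2 ⟨c, rfl⟩) fun v hv ↦ ?_).trans
        (map_zero _).symm)
      obtain ⟨c', hc'⟩ := (hJ.mem_iff_self v).1 hv
      rw [← hc']
      exact (Ω.inChart_two_self x _ _).symm.trans (hc c')
    · filter_upwards [hJ.mem_iff, hsrc] with z hz hzs
      rw [Bivector.inChart, fieldInChart_apply hzs]
      exact (hz _).1 (hmem z _)
    · filter_upwards [hJ.exists_mem, hsrc] with z hz hzs c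
      obtain ⟨v, hv, hvc⟩ := hz c
      rw [Bivector.inChart, fieldInChart_apply hzs, ← hvc, Ω.inChart_two_apply hzs, hΛ z _ v hv]
      rfl
  have hself : ∀ a : TangentSpace I x →L[ℝ] ℝ, Λ.inChart x (extChartAt I x x) a = Λ x a :=
    fun a ↦ Λ.inChart_self a
  have hcurv : ∀ a b : TangentSpace I x →L[ℝ] ℝ, curvature h x (Λ x a) (Λ x b) =
      -(lieBracket ℝ (fun y ↦ Λ.inChart x y a) (fun y ↦ Λ.inChart x y b) (extChartAt I x x) -
        projInChart h x (extChartAt I x x) (lieBracket ℝ (fun y ↦ Λ.inChart x y a)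
          (fun y ↦ Λ.inChart x y b) (extChartAt I x x))) := by
    intro a b
    have hext : ∀ u : TangentSpace I x, DifferentiableAt ℝ
        (fieldInChart x (FiberBundle.extend E u)) (extChartAt I x x) := fun u ↦
      (contDiffAt_fieldInChart (n := 1) (by simp)
        (FiberBundle.contMDiffAt_extend I E u)).differentiableAt one_ne_zero
    have hPΛ : ∀ a : E →L[ℝ] ℝ, (fun y ↦ projInChart h x y (Λ.inChart x y a))
        =ᶠ[𝓝 (extChartAt I x x)] fun y ↦ Λ.inChart x y a := by
      intro a
      refine eventually_nhds_extChartAt ?_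
      filter_upwards [hsrc] with z hzs
      rw [Bivector.inChart, fieldInChart_apply hzs, projInChart_apply h hzs,
        Submodule.projection_apply_of_mem_left _ (hmem z _)]
    -- The curvature is computed from arbitrary extensions of `Λ x a` and `Λ x b`, not from the
    -- fields `Λ a` and `Λ b`. Both choices give the same expression in the derivative of the
    -- projection, and `Λ a`, `Λ b` are fixed by the projection because they lie in `C`.
    have e1 := sub_proj_lieBracket hP (hd a) (hd b) (projInChart_projInChart h x)
    rw [Filter.EventuallyEq.lieBracket_vectorField_eq (hPΛ a) (hPΛ b)] at e1
    rw [e1, curvature, curvatureField_eq h hP (hext _) (hext _)]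
    rw [hself, hself, FiberBundle.extend_apply_self, FiberBundle.extend_apply_self]
  have key := jacobiator_eq (Λ := Λ.inChart x) (projInChart h x (extChartAt I x x)) hΩ hd ?_ ?_
    (κ := fun a b ↦ curvature h x (Λ x a) (Λ x b)) hcurv α β γ
  · have hs : 1 / 2 * schouten Λ Λ x α β γ =
        Λ.bracket (coordFun x α) (Λ.bracket (coordFun x β) (coordFun x γ)) x +
        Λ.bracket (coordFun x β) (Λ.bracket (coordFun x γ) (coordFun x α)) x +
        Λ.bracket (coordFun x γ) (Λ.bracket (coordFun x α) (coordFun x β)) x := by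
      simp only [schouten]; ring
    rw [hs, bracket_bracket_coordFun hd, bracket_bracket_coordFun hd, bracket_bracket_coordFun hd,
      Ω.d_apply]
    simp only [hself] at key
    refine key.trans ?_
    simp only [← Ω.inChart_two_self]
    rfl
  · refine eventually_nhds_extChartAt ?_
    filter_upwards [hsrc] with z hzs a b
    rw [Bivector.inChart, Bivector.inChart, fieldInChart_apply hzs, fieldInChart_apply hzs,
      Ω.inChart_two_apply hzs]
    refine (two_form_swap (V := E) (Ω z) _ _).trans ?_
    refine (congrArg Neg.neg (hΛ z _ _ (hmem z _))).trans ?_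
    rw [neg_neg]
    rfl
  · intro a v
    have h1 := projInChart_self h x v
    have h2 := Ω.inChart_two_self x (Λ x a) ((C x).projection (W x) (h x) v)
    have h0 := Λ.inChart_self (x := x) a
    rw [h0, h1]
    exact h2.trans (hΛ x a _ (Submodule.projection_apply_mem _ _))

end Jacobiator

/-! ### Linear algebra of the gauge transformation: `Ω` becomes `Ω - B` on `C`. -/

section GaugeAlgebra

variable {E : Type*} [NormedAddCommGroup E] [NormedSpace ℝ E] {H : Type*} [TopologicalSpace H]
  {I : ModelWithCorners ℝ E H} {M : Type*} [TopologicalSpace M] [ChartedSpace H M]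
  {C : ∀ x : M, Submodule ℝ (TangentSpace I x)} {Ω B : DiffForm I M 2} {Λ : Bivector I M}

theorem flat_apply {x : M} (η : TangentSpace I x [⋀^Fin 2]→L[ℝ] ℝ) (v w : TangentSpace I x) :
    flat η v w = η ![v, w] := rfl

theorem bivectorOfForm_mem (x : M) (α : TangentSpace I x →L[ℝ] ℝ) :
    bivectorOfForm C Ω x α ∈ C x := by
  unfold bivectorOfForm
  split_ifs with h
  · exact (C x).neg_mem (Subtype.property _)
  · exact (C x).zero_mem

theorem form_bivectorOfForm {x : M} (h : Bijective (restrictForm (Ω x) (C x)))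
    (α : TangentSpace I x →L[ℝ] ℝ) {v : TangentSpace I x} (hv : v ∈ C x) :
    Ω x ![bivectorOfForm C Ω x α, v] = -α v := by
  have h1 : bivectorOfForm C Ω x α = -((LinearEquiv.ofBijective _ h).symm
      ((C x).dualRestrict (ContinuousLinearMap.coeLM ℝ α)) : TangentSpace I x) := by
    unfold bivectorOfForm
    rw [dif_pos h]
    rfl
  have h2 := LinearEquiv.apply_symm_apply (LinearEquiv.ofBijective _ h)
    ((C x).dualRestrict (ContinuousLinearMap.coeLM ℝ α))
  have h3 := congrArg (fun L : Module.Dual ℝ (C x) ↦ L ⟨v, hv⟩) h2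
  rw [h1, ← flat_apply, map_neg]
  exact congrArg Neg.neg h3

theorem bivectorOfForm_eq {x : M} (h : Bijective (restrictForm (Ω x) (C x)))
    {α : TangentSpace I x →L[ℝ] ℝ} {u : TangentSpace I x} (hu : u ∈ C x)
    (hα : ∀ v ∈ C x, Ω x ![u, v] = -α v) : bivectorOfForm C Ω x α = u := by
  have h1 : (⟨bivectorOfForm C Ω x α, bivectorOfForm_mem x α⟩ : C x) = ⟨u, hu⟩ := by
    apply h.1
    ext ⟨v, hv⟩
    exact (form_bivectorOfForm h α hv).trans (hα v hv).symm
  exact congrArg Subtype.val h1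

theorem gaugeEnd_apply (x : M) (α : TangentSpace I x →L[ℝ] ℝ) :
    gaugeEnd Λ B x α = α + flat (B x) (Λ x α) := rfl

theorem IsGaugeTransform.exists_eq {ΛB : Bivector I M} (h : IsGaugeTransform Λ B ΛB) (x : M)
    (α : TangentSpace I x →L[ℝ] ℝ) :
    ∃ α', gaugeEnd Λ B x α' = α ∧ ΛB x α = Λ x α' := by
  refine ⟨Ring.inverse (gaugeEnd Λ B x) α, ?_, ?_⟩
  -- `Ring.inverse` is zero on non-units, so the invertibility contained in the gauge hypothesis is
  -- what makes it a genuine inverse here.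
  · exact congrArg (fun L : Module.End ℝ (TangentSpace I x →L[ℝ] ℝ) ↦ L α)
      (Ring.mul_inverse_cancel _ (h x).1)
  · rw [(h x).2]
    rfl

theorem IsGaugeTransform.mem {ΛB : Bivector I M}
    (h : IsGaugeTransform (bivectorOfForm C Ω) B ΛB) (x : M) (α : TangentSpace I x →L[ℝ] ℝ) :
    ΛB x α ∈ C x := by
  obtain ⟨α', -, h2⟩ := h.exists_eq x α
  rw [h2]
  exact bivectorOfForm_mem x α'

/-- Write `α = α' + B^♭ (Λ α')`, so that `Λ_B α = Λ α'`. Then `Ω` contributes `-α' v`, and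
subtracting `B (Λ α', v)` completes this to `-α v`. -/
theorem IsGaugeTransform.form_eq {ΛB : Bivector I M}
    (h : IsGaugeTransform (bivectorOfForm C Ω) B ΛB)
    {x : M} (hΩ : Bijective (restrictForm (Ω x) (C x))) (α : TangentSpace I x →L[ℝ] ℝ)
    {v : TangentSpace I x} (hv : v ∈ C x) : (Ω - B) x ![ΛB x α, v] = -α v := by
  obtain ⟨α', h1, h2⟩ := h.exists_eq x α
  have h3 := form_bivectorOfForm hΩ α' hv
  have h4 : (Ω - B) x ![ΛB x α, v] = Ω x ![ΛB x α, v] - B x ![ΛB x α, v] := rfl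
  rw [h4, h2, h3, ← h1, gaugeEnd_apply]
  change -α' v - B x ![bivectorOfForm C Ω x α', v] =
    -(α' v + B x ![bivectorOfForm C Ω x α', v])
  ring

/-- Let `G = Id + B^♭ ∘ Λ` and `α = -i_u Ω`, so that `Λ α = u` and `G α = -i_u (Ω - B)`, which
vanishes on `C` by assumption. Then `Λ (G α) = 0`, hence `G (G α) = G α`, and injectivity of `G`
gives `G α = α`. Therefore `u = Λ α = 0`. -/
theorem IsGaugeTransform.nondegenerate {ΛB : Bivector I M}
    (h : IsGaugeTransform (bivectorOfForm C Ω) B ΛB)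
    {x : M} (hΩ : Bijective (restrictForm (Ω x) (C x))) {u : TangentSpace I x} (hu : u ∈ C x)
    (h0 : ∀ v ∈ C x, (Ω - B) x ![u, v] = 0) : u = 0 := by
  have h1 : bivectorOfForm C Ω x (-flat (Ω x) u) = u :=
    bivectorOfForm_eq hΩ hu fun v _ ↦ (neg_neg (Ω x ![u, v])).symm
  have h2 : ∀ v ∈ C x, gaugeEnd (bivectorOfForm C Ω) B x (-flat (Ω x) u) v = 0 := by
    intro v hv
    rw [gaugeEnd_apply, h1]
    change -Ω x ![u, v] + B x ![u, v] = 0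
    have h3 : Ω x ![u, v] - B x ![u, v] = 0 := h0 v hv
    linarith
  have h3 : bivectorOfForm C Ω x (gaugeEnd (bivectorOfForm C Ω) B x (-flat (Ω x) u)) = 0 := by
    refine bivectorOfForm_eq hΩ (C x).zero_mem fun v hv ↦ ?_
    rw [h2 v hv, neg_zero, ← flat_apply, map_zero]
    rfl
  have h4 : gaugeEnd (bivectorOfForm C Ω) B x
      (gaugeEnd (bivectorOfForm C Ω) B x (-flat (Ω x) u)) =
      gaugeEnd (bivectorOfForm C Ω) B x (-flat (Ω x) u) := by
    conv_lhs => rw [gaugeEnd_apply, h3, map_zero, add_zero]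
  have h5 := ((Module.End.isUnit_iff _).1 (h x).1).1 h4
  rw [← h1, ← h5, h3]

end GaugeAlgebra

/-! ### Smooth local frames read in a chart. -/

section Frames

variable {E : Type*} [NormedAddCommGroup E] [NormedSpace ℝ E] {H : Type*} [TopologicalSpace H]
  {I : ModelWithCorners ℝ E H} {M : Type*} [TopologicalSpace M] [ChartedSpace H M]
  [IsManifold I ∞ M] {D : ∀ x : M, Submodule ℝ (TangentSpace I x)} {r : ℕ}

attribute [local instance] isManifold_one_of_smooth

/-- A local frame in the chart at `x`. -/
def LocalFrame.inChart (f : LocalFrame D r) (x : M) (y : E) : (Fin r → ℝ) →L[ℝ] E :=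
  ∑ i, (ContinuousLinearMap.proj i : (Fin r → ℝ) →L[ℝ] ℝ).smulRight
    (fieldInChart x (f.field i) y)

theorem LocalFrame.inChart_apply (f : LocalFrame D r) (x : M) (y : E) (c : Fin r → ℝ) :
    f.inChart x y c = ∑ i, c i • fieldInChart x (f.field i) y := by
  simp [LocalFrame.inChart, sum_apply]

theorem LocalFrame.inChart_extChartAt (f : LocalFrame D r) {x z : M}
    (hz : z ∈ (extChartAt I x).source) (c : Fin r → ℝ) :
    f.inChart x (extChartAt I x z) c = chartDeriv I x z (∑ i, c i • f.field i z) := by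
  rw [f.inChart_apply, map_sum]
  refine Finset.sum_congr rfl fun i _ ↦ ?_
  rw [fieldInChart_apply hz, map_smul]

theorem LocalFrame.contDiffAt_fieldInChart [I.Boundaryless] (f : LocalFrame D r) {x : M}
    (hx : x ∈ f.baseSet) (i : Fin r) :
    ContDiffAt ℝ ∞ (fieldInChart x (f.field i)) (extChartAt I x x) :=
  Nonholonomic.contDiffAt_fieldInChart le_rfl
    ((f.smooth i).contMDiffAt (f.isOpen_baseSet.mem_nhds hx))

theorem LocalFrame.differentiableAt_inChart [I.Boundaryless] (f : LocalFrame D r) {x : M}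
    (hx : x ∈ f.baseSet) : DifferentiableAt ℝ (f.inChart x) (extChartAt I x x) := by
  unfold LocalFrame.inChart
  refine DifferentiableAt.fun_sum fun i _ ↦ ?_
  exact ((ContinuousLinearMap.smulRightL ℝ (Fin r → ℝ) E
    (ContinuousLinearMap.proj i)).differentiableAt).comp _
      ((f.contDiffAt_fieldInChart hx i).differentiableAt (by simp))

theorem LocalFrame.mem_iff_exists (f : LocalFrame D r) {z : M} (hz : z ∈ f.baseSet)
    (v : TangentSpace I z) : v ∈ D z ↔ ∃ c : Fin r → ℝ, v = ∑ i, c i • f.field i z := by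
  rw [← f.span_eq z hz, Submodule.mem_span_range_iff_exists_fun]
  exact ⟨fun ⟨c, hc⟩ ↦ ⟨c, hc.symm⟩, fun ⟨c, hc⟩ ↦ ⟨c, hc.symm⟩⟩

theorem LocalFrame.mem_iff_chartDeriv (f : LocalFrame D r) {x z : M} (hz : z ∈ f.baseSet)
    (hzx : z ∈ (extChartAt I x).source) (v : TangentSpace I z) :
    v ∈ D z ↔ ∃ c, chartDeriv I x z v = f.inChart x (extChartAt I x z) c := by
  rw [f.mem_iff_exists hz]
  refine exists_congr fun c ↦ ?_
  rw [f.inChart_extChartAt hzx]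
  refine ⟨fun h ↦ h ▸ rfl, fun h ↦ ?_⟩
  rw [← chartDerivSymm_apply hzx v, h, chartDerivSymm_apply hzx]

theorem LocalFrame.injective_inChart (f : LocalFrame D r) {x z : M} (hz : z ∈ f.baseSet)
    (hzx : z ∈ (extChartAt I x).source) : Injective (f.inChart x (extChartAt I x z)) := by
  rw [injective_iff_map_eq_zero]
  intro c hc
  rw [f.inChart_extChartAt hzx] at hc
  have h1 : ∑ i, c i • f.field i z = 0 := by
    rw [← chartDerivSymm_apply hzx (∑ i, c i • f.field i z), hc, map_zero]
  exact funext fun i ↦ Fintype.linearIndependent_iff.1 (f.linearIndependent z hz) c h1 i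

theorem LocalFrame.isFrameInChart [I.Boundaryless] (f : LocalFrame D r) {x : M}
    (hx : x ∈ f.baseSet) : IsFrameInChart D x (f.inChart x) where
  differentiableAt := f.differentiableAt_inChart hx
  mem_iff := by
    filter_upwards [f.isOpen_baseSet.mem_nhds hx,
      (isOpen_extChartAt_source (I := I) x).mem_nhds (mem_extChartAt_source x)] with z hz hzx
    exact f.mem_iff_chartDeriv hz hzx
  injective := f.injective_inChart hx (mem_extChartAt_source x)

end Frames

/-! ### Pullback of forms and its compatibility with the exterior derivative. -/

section Pullback

variable {E : Type*} [NormedAddCommGroup E] [NormedSpace ℝ E] {H : Type*} [TopologicalSpace H]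
  {I : ModelWithCorners ℝ E H} {M : Type*} [TopologicalSpace M] [ChartedSpace H M]
  {E' : Type*} [NormedAddCommGroup E'] [NormedSpace ℝ E'] {H' : Type*} [TopologicalSpace H']
  {I' : ModelWithCorners ℝ E' H'} {M' : Type*} [TopologicalSpace M'] [ChartedSpace H' M']
  {F : Type*} [NormedAddCommGroup F] [NormedSpace ℝ F] {k : ℕ}

theorem DiffForm.pullback_apply (f : M → M') (η : DiffForm I' M' k) (x : M)
    (v : Fin k → TangentSpace I x) :
    η.pullback (I := I) f x v = η (f x) (fun i ↦ mfderiv I I' f x (v i)) := rfl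

theorem DiffForm.pullback_pullback {f : M → M'} {g : F → M} {η : DiffForm I' M' k} {y : F}
    (hf : MDifferentiableAt I I' f (g y)) (hg : MDifferentiableAt 𝓘(ℝ, F) I g y) :
    (η.pullback (I := I) f).pullback (I := 𝓘(ℝ, F)) g y = η.pullback (I := 𝓘(ℝ, F)) (f ∘ g) y := by
  ext v
  rw [pullback_apply, pullback_apply, pullback_apply, mfderiv_comp y hf hg]
  rfl

attribute [local instance] isManifold_one_of_smooth

/-- The exterior derivative commutes with pullbacks. -/
theorem DiffForm.pullback_d [IsManifold I' ∞ M'] [I'.Boundaryless] {f : F → M'}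
    {η : DiffForm I' M' k} {y : F} (hf : ContMDiffAt 𝓘(ℝ, F) I' 2 f y)
    (hη : DifferentiableAt ℝ (η.inChart (f y)) (extChartAt I' (f y) (f y))) :
    η.d.pullback (I := 𝓘(ℝ, F)) f y = extDeriv (η.pullback (I := 𝓘(ℝ, F)) f) y := by
  have : IsManifold I' 2 M' := IsManifold.of_le (n := ∞)
    (WithTop.coe_le_coe.2 le_top)
  -- Reduction to normed spaces: near `y`, `f^* η` is the pullback by `g` of the chart expression of
  -- `η`. The derivative of `g` need only be matched with that of `f`, followed by the chart
  -- derivative.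
  let g : F → E' := fun y' ↦ extChartAt I' (f y) (f y')
  have hg : ContDiffAt ℝ 2 g y :=
    (ContMDiffAt.comp y (contMDiffAt_extChartAt (I := I') (n := 2) (x := f y)) hf).contDiffAt
  have hfd : ∀ᶠ y' in 𝓝 y, MDifferentiableAt 𝓘(ℝ, F) I' f y' := by
    filter_upwards [(contMDiffAt_iff_contMDiffAt_nhds (by simp)).1 hf] with y' hy'
    exact hy'.mdifferentiableAt (by simp)
  have hsrc : ∀ᶠ y' in 𝓝 y, f y' ∈ (extChartAt I' (f y)).source :=
    hf.continuousAt ((isOpen_extChartAt_source (I := I') (f y)).mem_nhds (mem_extChartAt_source _))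
  have hgd : ∀ᶠ y' in 𝓝 y, ∀ v : F, fderiv ℝ g y' v =
      chartDeriv I' (f y) (f y') (mfderiv 𝓘(ℝ, F) I' f y' v) := by
    filter_upwards [hfd, hsrc] with y' h1 h2 v
    have h3 := mfderiv_comp y' (mdifferentiableAt_extChartAt (I := I') (x := f y) (y := f y')
      (by simpa using h2)) h1
    have h4 : (fderiv ℝ g y' : F →L[ℝ] E') = mfderiv 𝓘(ℝ, F) 𝓘(ℝ, E')
      (extChartAt I' (f y) ∘ f) y' := mfderiv_eq_fderiv.symm
    rw [← mfderiv_extChartAt_eq h2]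
    exact congrArg (fun L : F →L[ℝ] E' ↦ L v) (h4.trans h3)
  have hev : η.pullback (I := 𝓘(ℝ, F)) f =ᶠ[𝓝 y] fun y' ↦
      (η.inChart (f y) (g y')).compContinuousLinearMap (fderiv ℝ g y') := by
    filter_upwards [hgd, hsrc] with y' h1 h2
    ext v
    have h3 := η.inChart_extChartAt h2 (fun i ↦ mfderiv 𝓘(ℝ, F) I' f y' (v i))
    refine h3.symm.trans ?_
    exact congrArg (η.inChart (f y) (g y')) (funext fun i ↦ (h1 (v i)).symm)
  rw [hev.extDeriv_eq, extDeriv_pullback (r := 2) (f := g)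
    (show DifferentiableAt ℝ (η.inChart (f y)) (g y) from hη) hg (by simp)]
  ext v
  rw [pullback_apply, DiffForm.d_apply]
  exact congrArg (extDeriv (η.inChart (f y)) (extChartAt I' (f y) (f y))) (funext fun i ↦
    ((hgd.self_of_nhds (v i)).trans (chartDeriv_self _ _)).symm)

end Pullback

/-! ### Charts on the total space of a bundle: base chart and fibre coordinate. -/

section TotalSpaceCharts

variable {E : Type*} [NormedAddCommGroup E] [NormedSpace ℝ E]
  {Q : Type*} [TopologicalSpace Q] [ChartedSpace E Q]
  {F : Type*} [NormedAddCommGroup F] [NormedSpace ℝ F] {Z : Q → Type*}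
  [TopologicalSpace (TotalSpace F Z)] [∀ q, TopologicalSpace (Z q)] [FiberBundle F Z]

theorem mem_extChartAt_totalSpace_source {m z : TotalSpace F Z} :
    z ∈ (extChartAt (𝓘(ℝ, E).prod 𝓘(ℝ, F)) m).source ↔
      z.1 ∈ (trivializationAt F Z m.1).baseSet ∧ z.1 ∈ (extChartAt 𝓘(ℝ, E) m.1).source := by
  rw [FiberBundle.extChartAt]
  simp only [PartialEquiv.trans_source, mem_inter_iff, mem_preimage, PartialEquiv.prod_source,
    PartialEquiv.refl_source, mem_prod, mem_univ, and_true]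
  rw [← Trivialization.mem_source]
  refine and_congr_right fun hz ↦ ?_
  have : ((trivializationAt F Z m.1).toPartialEquiv z).1 = z.1 :=
    (trivializationAt F Z m.1).coe_fst hz
  rw [this]

theorem extChartAt_totalSpace_apply {m z : TotalSpace F Z}
    (hz : z.1 ∈ (trivializationAt F Z m.1).baseSet) :
    extChartAt (𝓘(ℝ, E).prod 𝓘(ℝ, F)) m z =
      (extChartAt 𝓘(ℝ, E) m.1 z.1, (trivializationAt F Z m.1 z).2) := by
  rw [FiberBundle.extChartAt]
  have : ((trivializationAt F Z m.1) z).1 = z.1 :=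
    (trivializationAt F Z m.1).coe_fst ((Trivialization.mem_source _).2 hz)
  change (extChartAt 𝓘(ℝ, E) m.1 ((trivializationAt F Z m.1) z).1, _) = _
  rw [this]
  rfl

theorem proj_extChartAt_totalSpace_symm {m : TotalSpace F Z} {y : E × F}
    (hy : y ∈ (extChartAt (𝓘(ℝ, E).prod 𝓘(ℝ, F)) m).target) :
    ((extChartAt (𝓘(ℝ, E).prod 𝓘(ℝ, F)) m).symm y).1 = (extChartAt 𝓘(ℝ, E) m.1).symm y.1 := by
  have hz := mem_extChartAt_totalSpace_source.1
    ((extChartAt (𝓘(ℝ, E).prod 𝓘(ℝ, F)) m).map_target hy)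
  have h := extChartAt_totalSpace_apply (E := E) hz.1
  rw [(extChartAt (𝓘(ℝ, E).prod 𝓘(ℝ, F)) m).right_inv hy] at h
  conv_rhs => rw [h]
  exact ((extChartAt 𝓘(ℝ, E) m.1).left_inv hz.2).symm

theorem trivializationAt_extChartAt_totalSpace_symm {m : TotalSpace F Z} {y : E × F}
    (hy : y ∈ (extChartAt (𝓘(ℝ, E).prod 𝓘(ℝ, F)) m).target) :
    (trivializationAt F Z m.1 ((extChartAt (𝓘(ℝ, E).prod 𝓘(ℝ, F)) m).symm y)).2 = y.2 := by
  have hz := mem_extChartAt_totalSpace_source.1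
    ((extChartAt (𝓘(ℝ, E).prod 𝓘(ℝ, F)) m).map_target hy)
  have h := extChartAt_totalSpace_apply (E := E) hz.1
  rw [(extChartAt (𝓘(ℝ, E).prod 𝓘(ℝ, F)) m).right_inv hy] at h
  conv_rhs => rw [h]

theorem fst_mem_extChartAt_target {m : TotalSpace F Z} {y : E × F}
    (hy : y ∈ (extChartAt (𝓘(ℝ, E).prod 𝓘(ℝ, F)) m).target) :
    y.1 ∈ (extChartAt 𝓘(ℝ, E) m.1).target := by
  rw [FiberBundle.extChartAt_target (IB := 𝓘(ℝ, E)) m] at hy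
  exact hy.1.1

end TotalSpaceCharts

/-! ### The Liouville form in coordinates, `θ = p dq`. -/

section Liouville

variable {E : Type*} [NormedAddCommGroup E] [NormedSpace ℝ E]
  {Q : Type*} [TopologicalSpace Q] [ChartedSpace E Q] [IsManifold 𝓘(ℝ, E) ∞ Q]
  {F : Type*} [NormedAddCommGroup F] [NormedSpace ℝ F]

attribute [local instance] isManifold_one_of_smooth

/-- The fiber coordinate on `T*Q` in the chart of `Q` at `q₀`. -/
def momentum (q₀ : Q) (z : Cotangent E Q) : E →L[ℝ] ℝ :=
  z.2 ∘L chartDerivSymm 𝓘(ℝ, E) q₀ z.1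

/-- The trivialization of the bundle of covectors precomposes with the inverse trivialization of the
tangent bundle, so `momentum` is the fibre coordinate of the charts of `T*Q`. -/
theorem trivializationAt_cotangent_snd (q₀ : Q) (z : Cotangent E Q) :
    (trivializationAt (E →L[ℝ] ℝ) (fun q : Q ↦ TangentSpace 𝓘(ℝ, E) q →L[ℝ] ℝ) q₀ z).2 =
      momentum q₀ z := by
  ext v
  rw [hom_trivializationAt_apply]
  change (trivializationAt ℝ (fun _ : Q ↦ ℝ) q₀).continuousLinearMapAt ℝ z.1 (momentum q₀ z v) = _
  simp

/-- The 1-form `v ↦ p (v.1)` on `E × F`. -/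
def horizontalForm (F : Type*) [NormedAddCommGroup F] [NormedSpace ℝ F] :
    (E →L[ℝ] ℝ) →L[ℝ] (E × F) [⋀^Fin 1]→L[ℝ] ℝ :=
  (ContinuousAlternatingMap.ofSubsingletonLIE (𝕜 := ℝ) (E := E × F) (F := ℝ)
      (0 : Fin 1)).toContinuousLinearEquiv.toContinuousLinearMap ∘L
    (ContinuousLinearMap.compL ℝ (E × F) E ℝ).flip (ContinuousLinearMap.fst ℝ E F)

theorem horizontalForm_apply (p : E →L[ℝ] ℝ) (v : Fin 1 → E × F) :
    horizontalForm F p v = p (v 0).1 := rfl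

theorem contMDiffAt_extChartAt_symm_self {H M : Type*} [TopologicalSpace H]
    {I : ModelWithCorners ℝ E H} [TopologicalSpace M] [ChartedSpace H M] [IsManifold I ∞ M]
    [I.Boundaryless] {x : M} {y : E} (hy : y ∈ (extChartAt I x).target) :
    ContMDiffAt 𝓘(ℝ, E) I ∞ (extChartAt I x).symm y :=
  (contMDiffOn_extChartAt_symm x).contMDiffAt ((isOpen_extChartAt_target x).mem_nhds hy)

/-- If `j` lies over the inverse chart of `Q`, then `Tτ ∘ Tj` is the derivative of that inverse
chart applied to the first component, whence `j^* θ = p dq`. The fibre `F` is left free so as to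
cover both the charts of `T*Q` and those of the constraint manifold. -/
theorem liouvilleForm_pullback {q₀ : Q} {j : E × F → Cotangent E Q} {y : E × F}
    (hj : MDifferentiableAt 𝓘(ℝ, E × F) (cotangentModel E) j y)
    (hproj : (fun y ↦ (j y).1) =ᶠ[𝓝 y] fun y ↦ (extChartAt 𝓘(ℝ, E) q₀).symm y.1)
    (hy : y.1 ∈ (extChartAt 𝓘(ℝ, E) q₀).target) :
    (liouvilleForm E Q).pullback (I := 𝓘(ℝ, E × F)) j y =
      horizontalForm F (momentum q₀ (j y)) := by
  ext v
  rw [DiffForm.pullback_apply]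
  have h1 : MDifferentiableAt (cotangentModel E) 𝓘(ℝ, E)
      (TotalSpace.proj : Cotangent E Q → Q) (j y) :=
    (contMDiffAt_proj (n := 1) _).mdifferentiableAt one_ne_zero
  have h2 := mfderiv_comp y h1 hj
  have h3 : MDifferentiableAt 𝓘(ℝ, E) 𝓘(ℝ, E) (extChartAt 𝓘(ℝ, E) q₀).symm
      (ContinuousLinearMap.fst ℝ E F y) :=
    (contMDiffAt_extChartAt_symm_self hy).mdifferentiableAt (by simp)
  have h4 := mfderiv_comp y h3 (ContinuousLinearMap.fst ℝ E F).mdifferentiableAt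
  have h5 : mfderiv 𝓘(ℝ, E × F) 𝓘(ℝ, E) (TotalSpace.proj ∘ j) y =
      mfderiv 𝓘(ℝ, E × F) 𝓘(ℝ, E)
        ((extChartAt 𝓘(ℝ, E) q₀).symm ∘ ContinuousLinearMap.fst ℝ E F) y :=
    hproj.mfderiv_eq
  have h6 := mfderiv_extChartAt_symm_eq (I := 𝓘(ℝ, E)) hy
  have h7 : (j y).1 = (extChartAt 𝓘(ℝ, E) q₀).symm y.1 := hproj.self_of_nhds
  have h8 : ∀ v : E × F, (mfderiv (cotangentModel E) 𝓘(ℝ, E)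
      (TotalSpace.proj : Cotangent E Q → Q) (j y) (mfderiv 𝓘(ℝ, E × F) (cotangentModel E) j y v) :
        E) = chartDerivSymm 𝓘(ℝ, E) q₀ (j y).1 v.1 := by
    intro v
    have e1 := congrArg (fun L : E × F →L[ℝ] E ↦ L v) (h2.symm.trans (h5.trans h4))
    refine e1.trans ?_
    have e2 : (mfderiv 𝓘(ℝ, E × F) 𝓘(ℝ, E) (ContinuousLinearMap.fst ℝ E F) y :
      E × F →L[ℝ] E) = ContinuousLinearMap.fst ℝ E F := ContinuousLinearMap.mfderiv_eq _
    have e3 := congrArg (fun q ↦ (show E from chartDerivSymm 𝓘(ℝ, E) q₀ q v.1)) h7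
    refine Eq.trans ?_ e3.symm
    refine Eq.trans ?_ (congrArg (fun L : E →L[ℝ] E ↦ L v.1) h6)
    exact congrArg (fun L : E × F →L[ℝ] E ↦
      (mfderiv 𝓘(ℝ, E) 𝓘(ℝ, E) (extChartAt 𝓘(ℝ, E) q₀).symm y.1 : E →L[ℝ] E) (L v)) e2
  exact congrArg (show E →L[ℝ] ℝ from (j y).2) (h8 (v 0))

theorem differentiableAt_horizontalForm {V : Type*} [NormedAddCommGroup V] [NormedSpace ℝ V]
    {p : V → E →L[ℝ] ℝ} {y : V} (hp : DifferentiableAt ℝ p y) :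
    DifferentiableAt ℝ (fun y ↦ horizontalForm F (p y)) y :=
  DifferentiableAt.comp (g := fun a ↦ horizontalForm F a) (f := p) y
    (ContinuousLinearMap.differentiableAt _) hp

theorem liouvilleForm_inChart (z : Cotangent E Q) :
    ∀ᶠ y in 𝓝 (extChartAt (cotangentModel E) z z), (liouvilleForm E Q).inChart z y =
      horizontalForm (E →L[ℝ] ℝ) y.2 := by
  filter_upwards [extChartAt_target_mem_nhds (I := cotangentModel E) z] with y hy
  have h2 := liouvilleForm_pullback (q₀ := z.1) (j := (extChartAt (cotangentModel E) z).symm)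
    (y := y) ((contMDiffAt_extChartAt_symm_self hy).mdifferentiableAt (by simp)) ?_ ?_
  · refine h2.trans ?_
    rw [← trivializationAt_cotangent_snd]
    exact congrArg _ (trivializationAt_extChartAt_totalSpace_symm (E := E) hy)
  · filter_upwards [(isOpen_extChartAt_target (I := cotangentModel E) z).mem_nhds hy] with y' hy'
    exact proj_extChartAt_totalSpace_symm (E := E) hy'
  · exact fst_mem_extChartAt_target (E := E) hy

theorem differentiableAt_liouvilleForm_inChart (z : Cotangent E Q) :
    DifferentiableAt ℝ ((liouvilleForm E Q).inChart z) (extChartAt (cotangentModel E) z z) := by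
  have h : DifferentiableAt ℝ (fun y : E × (E →L[ℝ] ℝ) ↦ horizontalForm (E →L[ℝ] ℝ) y.2)
    (extChartAt (cotangentModel E) z z) := differentiableAt_horizontalForm differentiableAt_snd
  exact h.congr_of_eventuallyEq (liouvilleForm_inChart z)

end Liouville

/-! ### Exterior derivative of `p dq` for a variable momentum `p`. -/

section HorizontalForm

variable {E F : Type*} [NormedAddCommGroup E] [NormedSpace ℝ E]
  [NormedAddCommGroup F] [NormedSpace ℝ F] {p : E × F → E →L[ℝ] ℝ} {y : E × F}

theorem contDiffAt_horizontalForm {n : WithTop ℕ∞} (hp : ContDiffAt ℝ n p y) :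
    ContDiffAt ℝ n (fun y ↦ horizontalForm F (p y)) y :=
  ContDiffAt.comp (g := fun a ↦ horizontalForm F a) (f := p) y
    (ContinuousLinearMap.contDiff _).contDiffAt hp

theorem extDeriv_horizontalForm (hp : DifferentiableAt ℝ p y) (u v : E × F) :
    extDeriv (fun y ↦ horizontalForm F (p y)) y ![u, v] =
      fderiv ℝ p y u v.1 - fderiv ℝ p y v u.1 := by
  have hd : DifferentiableAt ℝ (fun y ↦ horizontalForm F (p y)) y :=
    differentiableAt_horizontalForm hp
  have hc : ∀ (w : Fin 1 → E × F) (u : E × F),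
      fderiv ℝ (fun y ↦ horizontalForm F (p y) w) y u = fderiv ℝ p y u (w 0).1 := by
    intro w u
    simp only [horizontalForm_apply]
    rw [fderiv_clm_apply hp (differentiableAt_const _)]
    simp
  have h : extDeriv (fun y ↦ horizontalForm F (p y)) y ![u, v] = ∑ i : Fin 2, (-1) ^ i.val •
      fderiv ℝ (fun y ↦ horizontalForm F (p y) (i.removeNth ![u, v])) y (![u, v] i) :=
    extDeriv_apply hd ![u, v]
  rw [h, Fin.sum_univ_two]
  simp only [hc]
  simp [Fin.removeNth]
  ring

theorem contDiffAt_extDeriv {V : Type*} [NormedAddCommGroup V] [NormedSpace ℝ V] {k : ℕ}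
    {η : V → V [⋀^Fin k]→L[ℝ] ℝ} {x : V} (h : ContDiffAt ℝ ∞ η x) :
    ContDiffAt ℝ ∞ (extDeriv η) x :=
  (ContinuousAlternatingMap.alternatizeUncurryFinCLM ℝ V ℝ).contDiff.contDiffAt.comp x
    (h.fderiv_right (by simp))

end HorizontalForm

/-! ### Smoothness of the inclusion; `Ω_M` in coordinates and its closedness. -/

section ConstraintForm

variable {E : Type*} [NormedAddCommGroup E] [NormedSpace ℝ E]
  {Q : Type*} [TopologicalSpace Q] [ChartedSpace E Q] [IsManifold 𝓘(ℝ, E) ∞ Q] {r : ℕ}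
  {κ : KineticMetric E Q} {D : RegularDistribution 𝓘(ℝ, E) Q r}

attribute [local instance] isManifold_one_of_smooth

/-- The local frame of `D` that defines the trivialization of the constraint submanifold at `q`. -/
def frameAt (D : RegularDistribution 𝓘(ℝ, E) Q r) (q : Q) : LocalFrame D.fiber r :=
  (D.exists_frame q).choose

theorem mem_frameAt_baseSet (D : RegularDistribution 𝓘(ℝ, E) Q r) (q : Q) :
    q ∈ (frameAt D q).baseSet := (D.exists_frame q).choose_spec

variable (κ) in
/-- The inverse of the Gram matrix of a local frame. -/
def LocalFrame.gramInv (f : LocalFrame D.fiber r) (q : Q) : Matrix (Fin r) (Fin r) ℝ :=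
  fun i j ↦ ((f.gram κ f q).det)⁻¹ * (f.gram κ f q).adjugate i j

theorem LocalFrame.contMDiffOn_gramInv (f : LocalFrame D.fiber r) (i j : Fin r) :
    ContMDiffOn 𝓘(ℝ, E) 𝓘(ℝ, ℝ) ∞ (fun q ↦ f.gramInv κ q i j) f.baseSet := by
  have hff : ∀ i j, ContMDiffOn 𝓘(ℝ, E) 𝓘(ℝ, ℝ) ∞ (fun q ↦ f.gram κ f q i j) f.baseSet :=
    fun i j ↦ (f.contMDiffOn_gram f i j).mono fun q hq ↦ ⟨hq, hq⟩
  refine ContMDiffOn.mul ((contMDiffOn_det hff).inv₀ fun q hq ↦ f.det_gram_ne_zero hq) ?_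
  simp only [Matrix.adjugate_apply]
  refine contMDiffOn_det fun a b ↦ ?_
  by_cases h : a = j
  · simp only [h, Matrix.updateRow_self]; exact contMDiffOn_const
  · simpa [Matrix.updateRow_ne h] using hff a b

theorem LocalFrame.sum_gram_mul_gramInv (f : LocalFrame D.fiber r) {q : Q} (hq : q ∈ f.baseSet)
    (b : Fin r → ℝ) (i : Fin r) :
    ∑ j, (∑ k, b k * f.gram κ f q k j) * f.gramInv κ q j i = b i := by
  have h1 := Matrix.mul_adjugate (f.gram κ f q)
  have h2 := f.det_gram_ne_zero (κ := κ) hq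
  calc _ = ((f.gram κ f q).det)⁻¹ *
        Matrix.vecMul (Matrix.vecMul b (f.gram κ f q)) (f.gram κ f q).adjugate i := by
          simp only [Matrix.vecMul, dotProduct, Finset.mul_sum, gramInv]
          exact Finset.sum_congr rfl fun k _ ↦ by ring
    _ = b i := by
          rw [Matrix.vecMul_vecMul, h1]
          simp [Matrix.vecMul_smul, h2]

/-- If `p = κ(v, ·)` with `v = ∑ b_i s_i`, the values `p(s_j)` are the Gram matrix applied to `b`,
so its inverse recovers `b`. This writes a point of the constraint manifold smoothly in terms of its
fibre coordinates `p(s_j)`. -/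
theorem LocalFrame.covector_eq (f : LocalFrame D.fiber r) {q : Q} (hq : q ∈ f.baseSet)
    (p : LegFiber κ D q) :
    p.1 = ∑ i, (∑ j, p.1 (f.field j q) * f.gramInv κ q j i) • κ.inner q (f.field i q) := by
  obtain ⟨p, v, hv, rfl⟩ := p
  obtain ⟨b, hb⟩ := f.exists_eq_sum hq hv
  have h1 : ∀ j, κ.inner q v (f.field j q) = ∑ k, b k * f.gram κ f q k j := by
    intro j
    simp only [gram, hb, map_sum, map_smul, sum_apply, smul_apply, smul_eq_mul]
  have h2 : ∀ i, ∑ j, κ.inner q v (f.field j q) * f.gramInv κ q j i = b i := by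
    intro i
    simp only [h1]
    exact f.sum_gram_mul_gramInv hq b i
  change κ.inner q v = ∑ i, (∑ j, κ.inner q v (f.field j q) * f.gramInv κ q j i) •
    κ.inner q (f.field i q)
  simp only [h2]
  conv_lhs => rw [hb, map_sum]
  simp only [map_smul]

theorem contMDiffAt_momentum_inner (f : LocalFrame D.fiber r) {q : Q} (hq : q ∈ f.baseSet)
    (i : Fin r) : ContMDiffAt 𝓘(ℝ, E) 𝓘(ℝ, E →L[ℝ] ℝ) ∞
      (fun q' ↦ momentum q (⟨q', κ.inner q' (f.field i q')⟩ : Cotangent E Q)) q := by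
  have h1 := (f.smooth i).contMDiffAt (f.isOpen_baseSet.mem_nhds hq)
  have h := ContMDiffAt.clm_bundle_apply (F₁ := E) (F₂ := E →L[ℝ] ℝ)
    (E₁ := fun q : Q ↦ TangentSpace 𝓘(ℝ, E) q)
    (E₂ := fun q : Q ↦ TangentSpace 𝓘(ℝ, E) q →L[ℝ] ℝ) (b := fun q ↦ q)
    (ϕ := fun q ↦ κ.inner q) (κ.contMDiff.contMDiffAt (x := q)) h1
  have h2 := (contMDiffAt_totalSpace.1 h).2
  simpa only [trivializationAt_cotangent_snd] using h2

/-- By `covector_eq`, the momentum is a combination of the covectors `κ(s_i, ·)`, whose coefficients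
are smooth in the base point and linear in the fibre coordinates. -/
theorem contMDiffAt_momentum_inclusion (m : ConstraintManifold κ D) :
    ContMDiffAt (constraintModel E r) 𝓘(ℝ, E →L[ℝ] ℝ) ∞
      (fun z ↦ momentum m.1 (inclusion κ D z)) m := by
  set f := frameAt D m.1
  have hf : m.1 ∈ f.baseSet := mem_frameAt_baseSet D m.1
  have hproj : ContMDiffAt (constraintModel E r) 𝓘(ℝ, E) ∞
      (TotalSpace.proj : ConstraintManifold κ D → Q) m := contMDiffAt_proj _
  have hev : (fun z : ConstraintManifold κ D ↦ momentum m.1 (inclusion κ D z)) =ᶠ[𝓝 m]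
      fun z ↦ ∑ i, (∑ j, (trivializationAt (Fin r → ℝ) (LegFiber κ D) m.1 z).2 j *
        f.gramInv κ z.1 j i) •
          momentum m.1 (⟨z.1, κ.inner z.1 (f.field i z.1)⟩ : Cotangent E Q) := by
    filter_upwards [hproj.continuousAt (f.isOpen_baseSet.mem_nhds hf)] with z hz
    have h1 := f.covector_eq (κ := κ) hz z.2
    ext v
    have h2 := congrArg (fun p : TangentSpace 𝓘(ℝ, E) z.1 →L[ℝ] ℝ ↦
      p (chartDerivSymm 𝓘(ℝ, E) m.1 z.1 v)) h1
    refine h2.trans ?_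
    simp only [sum_apply, smul_apply]
    rfl
  refine ContMDiffAt.congr_of_eventuallyEq ?_ hev
  have hc : ContMDiffAt (constraintModel E r) 𝓘(ℝ, Fin r → ℝ) ∞
      (fun z ↦ (trivializationAt (Fin r → ℝ) (LegFiber κ D) m.1 z).2) m :=
    (contMDiffAt_totalSpace.1 (contMDiffAt_id (x := m))).2
  refine contMDiffAt_finsetSum fun i _ ↦ ?_
  refine ContMDiffAt.smul (I := 𝓘(ℝ, ℝ)) (f := fun z : ConstraintManifold κ D ↦
    ∑ j, (trivializationAt (Fin r → ℝ) (LegFiber κ D) m.1 z).2 j * f.gramInv κ z.1 j i)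
    (g := fun z ↦ momentum m.1 (⟨z.1, κ.inner z.1 (f.field i z.1)⟩ : Cotangent E Q)) ?_ ?_
  · refine contMDiffAt_finsetSum fun j _ ↦ ContMDiffAt.mul ?_ ?_
    · exact ContMDiffAt.comp m (ContinuousLinearMap.proj (R := ℝ)
        (φ := fun _ : Fin r ↦ ℝ) j).contMDiff.contMDiffAt hc
    · exact ContMDiffAt.comp m ((f.contMDiffOn_gramInv j i).contMDiffAt
        (f.isOpen_baseSet.mem_nhds hf)) hproj
  · exact ContMDiffAt.comp m (contMDiffAt_momentum_inner f hf i) hproj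

theorem contMDiff_inclusion :
    ContMDiff (constraintModel E r) (cotangentModel E) ∞ (inclusion κ D) := fun m ↦ by
  refine contMDiffAt_totalSpace.2 ⟨contMDiffAt_proj _, ?_⟩
  simp only [trivializationAt_cotangent_snd]
  exact contMDiffAt_momentum_inclusion m

variable (κ D) in
/-- The momentum of the points of the constraint submanifold, in the chart at `m`. -/
def constraintMomentum (m : ConstraintManifold κ D) (y : E × (Fin r → ℝ)) : E →L[ℝ] ℝ :=
  momentum m.1 (inclusion κ D ((extChartAt (constraintModel E r) m).symm y))

theorem contDiffAt_constraintMomentum (m : ConstraintManifold κ D) :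
    ContDiffAt ℝ ∞ (constraintMomentum κ D m) (extChartAt (constraintModel E r) m m) := by
  have h1 := contMDiffAt_extChartAt_symm_self (mem_extChartAt_target (I := constraintModel E r) m)
  exact (ContMDiffAt.comp_of_eq (contMDiffAt_momentum_inclusion m) h1
    (extChartAt_to_inv m)).contDiffAt

theorem contMDiffAt_inclusion_extChartAt_symm (m : ConstraintManifold κ D) {y : E × (Fin r → ℝ)}
    (hy : y ∈ (extChartAt (constraintModel E r) m).target) :
    ContMDiffAt 𝓘(ℝ, E × (Fin r → ℝ)) (cotangentModel E) ∞
      (inclusion κ D ∘ (extChartAt (constraintModel E r) m).symm) y :=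
  ContMDiffAt.comp y (contMDiff_inclusion _) (contMDiffAt_extChartAt_symm_self hy)

theorem constraintForm_inChart_eq_pullback (m : ConstraintManifold κ D) {y : E × (Fin r → ℝ)}
    (hy : y ∈ (extChartAt (constraintModel E r) m).target) :
    (constraintForm κ D).inChart m y = (canonicalForm E Q).pullback
      (I := 𝓘(ℝ, E × (Fin r → ℝ))) (inclusion κ D ∘ (extChartAt (constraintModel E r) m).symm) y :=
  DiffForm.pullback_pullback ((contMDiff_inclusion _).mdifferentiableAt (by simp))
    ((contMDiffAt_extChartAt_symm_self hy).mdifferentiableAt (by simp))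

theorem canonicalForm_pullback (m : ConstraintManifold κ D) {y : E × (Fin r → ℝ)}
    (hy : y ∈ (extChartAt (constraintModel E r) m).target) :
    (canonicalForm E Q).pullback (I := 𝓘(ℝ, E × (Fin r → ℝ)))
      (inclusion κ D ∘ (extChartAt (constraintModel E r) m).symm) y =
      -extDeriv ((liouvilleForm E Q).pullback (I := 𝓘(ℝ, E × (Fin r → ℝ)))
        (inclusion κ D ∘ (extChartAt (constraintModel E r) m).symm)) y := by
  have h := DiffForm.pullback_d (η := liouvilleForm E Q)
    ((contMDiffAt_inclusion_extChartAt_symm m hy).of_le (WithTop.coe_le_coe.2 le_top))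
    (differentiableAt_liouvilleForm_inChart _)
  exact congrArg Neg.neg h

theorem liouvilleForm_pullback_inclusion (m : ConstraintManifold κ D) :
    ∀ᶠ y in 𝓝 (extChartAt (constraintModel E r) m m),
      (liouvilleForm E Q).pullback (I := 𝓘(ℝ, E × (Fin r → ℝ)))
        (inclusion κ D ∘ (extChartAt (constraintModel E r) m).symm) y =
      horizontalForm (Fin r → ℝ) (constraintMomentum κ D m y) := by
  filter_upwards [extChartAt_target_mem_nhds (I := constraintModel E r) m] with y hy
  refine liouvilleForm_pullback (q₀ := m.1)
    ((contMDiffAt_inclusion_extChartAt_symm m hy).mdifferentiableAt (by simp)) ?_ ?_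
  · filter_upwards [(isOpen_extChartAt_target (I := constraintModel E r) m).mem_nhds hy]
      with y' hy'
    change ((extChartAt (constraintModel E r) m).symm y').1 = _
    rw [proj_extChartAt_totalSpace_symm (E := E) (m := m) hy']
  · exact fst_mem_extChartAt_target (E := E) hy

/-- Pullback commutes with `d`, so `ι^* Ω_Q = -d(ι^* θ)`, and `ι^* θ` is `p dq`. The equality holds
on a neighbourhood, so it may be differentiated again. -/
theorem constraintForm_inChart (m : ConstraintManifold κ D) :
    ∀ᶠ y in 𝓝 (extChartAt (constraintModel E r) m m), (constraintForm κ D).inChart m y =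
      -extDeriv (fun y ↦ horizontalForm (Fin r → ℝ) (constraintMomentum κ D m y)) y := by
  have h : ∀ᶠ y in 𝓝 (extChartAt (constraintModel E r) m m),
      extDeriv ((liouvilleForm E Q).pullback (I := 𝓘(ℝ, E × (Fin r → ℝ)))
        (inclusion κ D ∘ (extChartAt (constraintModel E r) m).symm)) y =
      extDeriv (fun y ↦ horizontalForm (Fin r → ℝ) (constraintMomentum κ D m y)) y :=
    Filter.EventuallyEq.extDeriv (liouvilleForm_pullback_inclusion m)
  filter_upwards [extChartAt_target_mem_nhds (I := constraintModel E r) m, h] with y hy hy'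
  exact (constraintForm_inChart_eq_pullback m hy).trans
    ((canonicalForm_pullback m hy).trans (congrArg Neg.neg hy'))

theorem differentiableAt_constraintForm_inChart (m : ConstraintManifold κ D) :
    DifferentiableAt ℝ ((constraintForm κ D).inChart m)
      (extChartAt (constraintModel E r) m m) := by
  refine DifferentiableAt.congr_of_eventuallyEq ?_ (constraintForm_inChart m)
  exact ((contDiffAt_extDeriv (contDiffAt_horizontalForm
    (contDiffAt_constraintMomentum m))).differentiableAt (by simp)).neg

theorem extDeriv_constraintForm_inChart (m : ConstraintManifold κ D) :
    extDeriv ((constraintForm κ D).inChart m) (extChartAt (constraintModel E r) m m) = 0 := by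
  have h0 : (constraintForm κ D).inChart m =ᶠ[𝓝 (extChartAt (constraintModel E r) m m)]
      fun y ↦ -extDeriv (fun y ↦ horizontalForm (Fin r → ℝ) (constraintMomentum κ D m y)) y :=
    constraintForm_inChart m
  rw [h0.extDeriv_eq]
  have h := extDeriv_smul (-1 : ℝ) (extDeriv fun y ↦
    horizontalForm (Fin r → ℝ) (constraintMomentum κ D m y))
    (x := extChartAt (constraintModel E r) m m)
  have h' : ((-1 : ℝ) • extDeriv fun y ↦
      horizontalForm (Fin r → ℝ) (constraintMomentum κ D m y)) =
      fun y ↦ -extDeriv (fun y ↦ horizontalForm (Fin r → ℝ) (constraintMomentum κ D m y)) y := by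
    funext y
    simp
  rw [h'] at h
  rw [h, extDeriv_extDeriv_apply (contDiffAt_horizontalForm (contDiffAt_constraintMomentum m))
    (by simpa using WithTop.coe_le_coe.2 (le_top : (2 : ℕ∞) ≤ ⊤)), smul_zero]

/-- The fibre coordinates are by construction the values of the covector on the frame of `D`.
Differentiating this identity along the fibres yields nondegeneracy. -/
theorem constraintMomentum_frame (m : ConstraintManifold κ D) (i : Fin r) :
    ∀ᶠ y in 𝓝 (extChartAt (constraintModel E r) m m),
      constraintMomentum κ D m y (fieldInChart m.1 ((frameAt D m.1).field i) y.1) = y.2 i := by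
  refine eventually_nhds_extChartAt ?_
  filter_upwards [(isOpen_extChartAt_source (I := constraintModel E r) m).mem_nhds
    (mem_extChartAt_source m)] with z hz
  have hz' := mem_extChartAt_totalSpace_source.1 hz
  have h1 : extChartAt (constraintModel E r) m z = _ :=
    extChartAt_totalSpace_apply (E := E) hz'.1
  rw [constraintMomentum, (extChartAt (constraintModel E r) m).left_inv hz, h1,
    fieldInChart_apply hz'.2]
  change (inclusion κ D z).2 (chartDerivSymm 𝓘(ℝ, E) m.1 z.1 (chartDeriv 𝓘(ℝ, E) m.1 z.1 _)) = _
  rw [chartDerivSymm_apply hz'.2]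
  rfl

end ConstraintForm

/-! ### A frame of the constraint distribution; nondegeneracy of `Ω_M` on it. -/

section ConstraintFrame

variable {E : Type*} [NormedAddCommGroup E] [NormedSpace ℝ E]
  {Q : Type*} [TopologicalSpace Q] [ChartedSpace E Q] [IsManifold 𝓘(ℝ, E) ∞ Q] {r : ℕ}
  {κ : KineticMetric E Q} {D : RegularDistribution 𝓘(ℝ, E) Q r}

attribute [local instance] isManifold_one_of_smooth

theorem fst_extChartAt_self (m : ConstraintManifold κ D) :
    (extChartAt (constraintModel E r) m m).1 = extChartAt 𝓘(ℝ, E) m.1 m.1 := by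
  rw [extChartAt_totalSpace_apply (E := E)
    (mem_baseSet_trivializationAt (Fin r → ℝ) (LegFiber κ D) m.1)]

/-- The chart of the constraint manifold covers that of `Q`. Differentiating this, membership in `C`
becomes a condition on the first component alone. -/
theorem fst_chartDeriv {m z : ConstraintManifold κ D}
    (hz : z ∈ (extChartAt (constraintModel E r) m).source)
    (v : TangentSpace (constraintModel E r) z) :
    (chartDeriv (constraintModel E r) m z v).1 =
      chartDeriv 𝓘(ℝ, E) m.1 z.1 (mfderiv (constraintModel E r) 𝓘(ℝ, E)
        (TotalSpace.proj : ConstraintManifold κ D → Q) z v) := by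
  have hz' := mem_extChartAt_totalSpace_source.1 hz
  have hp : MDifferentiableAt (constraintModel E r) 𝓘(ℝ, E)
      (TotalSpace.proj : ConstraintManifold κ D → Q) z :=
    (contMDiffAt_proj (n := 1) _).mdifferentiableAt one_ne_zero
  have h1 : MDifferentiableAt 𝓘(ℝ, E) 𝓘(ℝ, E) (extChartAt 𝓘(ℝ, E) m.1) z.1 :=
    mdifferentiableAt_extChartAt (by simpa using hz'.2)
  have h2 : MDifferentiableAt (constraintModel E r) 𝓘(ℝ, E × (Fin r → ℝ))
      (extChartAt (constraintModel E r) m) z :=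
    mdifferentiableAt_extChartAt (by simpa using hz)
  have h3 : MDifferentiableAt 𝓘(ℝ, E × (Fin r → ℝ)) 𝓘(ℝ, E)
      (ContinuousLinearMap.fst ℝ E (Fin r → ℝ)) (extChartAt (constraintModel E r) m z) :=
    ContinuousLinearMap.mdifferentiableAt _
  have e1 := mfderiv_comp z h1 hp
  have e2 := mfderiv_comp z h3 h2
  have hev : (ContinuousLinearMap.fst ℝ E (Fin r → ℝ) ∘ extChartAt (constraintModel E r) m)
      =ᶠ[𝓝 z] (extChartAt 𝓘(ℝ, E) m.1 ∘ TotalSpace.proj) := by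
    filter_upwards [(isOpen_extChartAt_source (I := constraintModel E r) m).mem_nhds hz]
      with z' hz''
    change (extChartAt (constraintModel E r) m z').1 = _
    rw [extChartAt_totalSpace_apply (E := E) (mem_extChartAt_totalSpace_source.1 hz'').1]
    rfl
  have e3 : mfderiv (constraintModel E r) 𝓘(ℝ, E)
      (ContinuousLinearMap.fst ℝ E (Fin r → ℝ) ∘ extChartAt (constraintModel E r) m) z =
      mfderiv (constraintModel E r) 𝓘(ℝ, E) (extChartAt 𝓘(ℝ, E) m.1 ∘ TotalSpace.proj) z :=
    hev.mfderiv_eq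
  have e4 : (mfderiv 𝓘(ℝ, E × (Fin r → ℝ)) 𝓘(ℝ, E) (ContinuousLinearMap.fst ℝ E (Fin r → ℝ))
      (extChartAt (constraintModel E r) m z) : E × (Fin r → ℝ) →L[ℝ] E) =
      ContinuousLinearMap.fst ℝ E (Fin r → ℝ) := ContinuousLinearMap.mfderiv_eq _
  have e5 := mfderiv_extChartAt_eq (I := constraintModel E r) hz
  have e6 := mfderiv_extChartAt_eq (I := 𝓘(ℝ, E)) hz'.2
  have e7 := congrArg (fun L : E × (Fin r → ℝ) →L[ℝ] E ↦ L v) (e2.symm.trans (e3.trans e1))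
  have e8 := congrArg (fun L : E × (Fin r → ℝ) →L[ℝ] E × (Fin r → ℝ) ↦ (L v).1) e5
  have e9 := congrArg (fun L : E →L[ℝ] E ↦ L (mfderiv (constraintModel E r) 𝓘(ℝ, E)
        (TotalSpace.proj : ConstraintManifold κ D → Q) z v)) e6
  have e10 := congrArg (fun L : E × (Fin r → ℝ) →L[ℝ] E ↦ L
    ((mfderiv (constraintModel E r) 𝓘(ℝ, E × (Fin r → ℝ)) (extChartAt (constraintModel E r) m) z :
      E × (Fin r → ℝ) →L[ℝ] E × (Fin r → ℝ)) v)) e4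
  exact e8.symm.trans (e10.symm.trans (e7.trans e9))

variable (κ D) in
/-- The frame of the constraint distribution that the frame of `D` and the fiber coordinates
define, in the chart at `m`. -/
def constraintFrame (m : ConstraintManifold κ D) (y : E × (Fin r → ℝ)) :
    ((Fin r → ℝ) × (Fin r → ℝ)) →L[ℝ] E × (Fin r → ℝ) :=
  ((frameAt D m.1).inChart m.1 y.1).prodMap (ContinuousLinearMap.id ℝ (Fin r → ℝ))

theorem differentiableAt_constraintFrame (m : ConstraintManifold κ D) :
    DifferentiableAt ℝ (constraintFrame κ D m) (extChartAt (constraintModel E r) m m) := by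
  have h1 : DifferentiableAt ℝ ((frameAt D m.1).inChart m.1)
      (extChartAt (constraintModel E r) m m).1 := by
    rw [fst_extChartAt_self]
    exact (frameAt D m.1).differentiableAt_inChart (mem_frameAt_baseSet D m.1)
  have h2 : DifferentiableAt ℝ (fun y : E × (Fin r → ℝ) ↦ (frameAt D m.1).inChart m.1 y.1)
      (extChartAt (constraintModel E r) m m) := h1.comp _ differentiableAt_fst
  have h3 := DifferentiableAt.comp
    (g := fun a ↦ ContinuousLinearMap.prodMapL ℝ (Fin r → ℝ) E (Fin r → ℝ) (Fin r → ℝ) a)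
    (f := fun y : E × (Fin r → ℝ) ↦
      ((frameAt D m.1).inChart m.1 y.1, ContinuousLinearMap.id ℝ (Fin r → ℝ))) _
    (ContinuousLinearMap.differentiableAt _) (h2.prodMk (differentiableAt_const _))
  exact h3

theorem isFrameInChart_constraintFrame (m : ConstraintManifold κ D) :
    IsFrameInChart (constraintDistribution κ D) m (constraintFrame κ D m) where
  differentiableAt := differentiableAt_constraintFrame m
  mem_iff := by
    filter_upwards [(isOpen_extChartAt_source (I := constraintModel E r) m).mem_nhds
      (mem_extChartAt_source m)] with z hz v
    have hz' := mem_extChartAt_totalSpace_source.1 hz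
    have h1 := (frameAt D m.1).mem_iff_chartDeriv hz'.1 hz'.2
      (mfderiv (constraintModel E r) 𝓘(ℝ, E) (TotalSpace.proj : ConstraintManifold κ D → Q) z v)
    rw [← fst_chartDeriv hz v] at h1
    have h2 : extChartAt (constraintModel E r) m z = _ :=
      extChartAt_totalSpace_apply (E := E) hz'.1
    have h3 : (extChartAt (constraintModel E r) m z).1 = extChartAt 𝓘(ℝ, E) m.1 z.1 := by rw [h2]
    refine h1.trans ⟨fun ⟨c, hc⟩ ↦ ⟨(c, (chartDeriv (constraintModel E r) m z v).2), ?_⟩,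
      fun ⟨c, hc⟩ ↦ ⟨c.1, ?_⟩⟩
    · refine Prod.ext ?_ rfl
      change _ = (frameAt D m.1).inChart m.1 (extChartAt (constraintModel E r) m z).1 c
      rw [h3]
      exact hc
    · rw [← h3]
      exact congrArg Prod.fst hc
  injective := by
    rintro ⟨a, w⟩ ⟨a', w'⟩ h
    have h1 := (frameAt D m.1).injective_inChart (mem_frameAt_baseSet D m.1)
      (mem_extChartAt_source (I := 𝓘(ℝ, E)) m.1)
    rw [← fst_extChartAt_self m] at h1
    have h2 : w = w' := congrArg (fun c : E × (Fin r → ℝ) ↦ c.2) h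
    exact Prod.ext (h1 (congrArg Prod.fst h)) h2

/-- In the derivative of `p(s_i) = y.2 i` along a vertical vector, the frame contributes nothing,
since it depends on the base point only. -/
theorem fderiv_constraintMomentum_frame (m : ConstraintManifold κ D) (w : Fin r → ℝ)
    (i : Fin r) :
    fderiv ℝ (constraintMomentum κ D m) (extChartAt (constraintModel E r) m m) (0, w)
      (fieldInChart m.1 ((frameAt D m.1).field i) (extChartAt (constraintModel E r) m m).1) =
      w i := by
  set y := extChartAt (constraintModel E r) m m with hy
  set s := fieldInChart m.1 ((frameAt D m.1).field i)
  have hp : DifferentiableAt ℝ (constraintMomentum κ D m) y :=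
    (contDiffAt_constraintMomentum m).differentiableAt (by simp)
  have hs : DifferentiableAt ℝ s y.1 := by
    rw [hy, fst_extChartAt_self]
    exact ((frameAt D m.1).contDiffAt_fieldInChart (mem_frameAt_baseSet D m.1)
      i).differentiableAt (by simp)
  have h1 : HasFDerivAt (fun y : E × (Fin r → ℝ) ↦ s y.1)
      (fderiv ℝ s y.1 ∘L ContinuousLinearMap.fst ℝ E (Fin r → ℝ)) y :=
    hs.hasFDerivAt.comp y hasFDerivAt_fst
  have h2 := hp.hasFDerivAt.clm_apply h1
  have h3 : HasFDerivAt (fun y : E × (Fin r → ℝ) ↦ y.2 i)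
      (ContinuousLinearMap.proj i ∘L ContinuousLinearMap.snd ℝ E (Fin r → ℝ)) y :=
    ContinuousLinearMap.hasFDerivAt (ContinuousLinearMap.proj (R := ℝ)
      (φ := fun _ : Fin r ↦ ℝ) i ∘L ContinuousLinearMap.snd ℝ E (Fin r → ℝ))
  have h4 : (fun y : E × (Fin r → ℝ) ↦ constraintMomentum κ D m y (s y.1)) =ᶠ[𝓝 y]
      fun y ↦ y.2 i := constraintMomentum_frame m i
  have h5 := congrArg (fun L : E × (Fin r → ℝ) →L[ℝ] ℝ ↦ L (0, w))
    ((h2.congr_of_eventuallyEq h4.symm).unique h3)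
  simpa using h5

theorem constraintForm_apply (m : ConstraintManifold κ D) (u v : E × (Fin r → ℝ)) :
    (constraintForm κ D).inChart m (extChartAt (constraintModel E r) m m) ![u, v] =
      fderiv ℝ (constraintMomentum κ D m) (extChartAt (constraintModel E r) m m) v u.1 -
      fderiv ℝ (constraintMomentum κ D m) (extChartAt (constraintModel E r) m m) u v.1 := by
  rw [(constraintForm_inChart m).self_of_nhds, ContinuousAlternatingMap.neg_apply,
    extDeriv_horizontalForm ((contDiffAt_constraintMomentum m).differentiableAt (by simp)),
    neg_sub]

/-- In the frame of `C` made of lifts of the frame of `D` and of vertical vectors, the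
vertical-vertical block of `Ω_M` vanishes and the mixed blocks are plus and minus the identity,
whatever the remaining block is. -/
theorem constraintForm_nondegenerate (m : ConstraintManifold κ D)
    {u : TangentSpace (constraintModel E r) m} (hu : u ∈ constraintDistribution κ D m)
    (h : ∀ v ∈ constraintDistribution κ D m, constraintForm κ D m ![u, v] = 0) : u = 0 := by
  have hJ := isFrameInChart_constraintFrame m
  set y := extChartAt (constraintModel E r) m m with hy
  obtain ⟨⟨a, w⟩, haw⟩ := (hJ.mem_iff_self u).1 hu
  have h1 : ∀ c, (constraintForm κ D).inChart m y
      ![constraintFrame κ D m y (a, w), constraintFrame κ D m y c] = 0 := by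
    intro c
    rw [haw]
    exact ((constraintForm κ D).inChart_two_self m u _).trans
      (h _ ((hJ.mem_iff_self _).2 ⟨c, rfl⟩))
  have h2 : ∀ c : Fin r → ℝ, ∀ w : Fin r → ℝ,
      fderiv ℝ (constraintMomentum κ D m) y (0, w) ((frameAt D m.1).inChart m.1 y.1 c) =
        ∑ i, c i * w i := by
    intro c w
    rw [LocalFrame.inChart_apply, map_sum]
    refine Finset.sum_congr rfl fun i _ ↦ ?_
    rw [map_smul, fderiv_constraintMomentum_frame m w i, smul_eq_mul]
  -- Pairing with the `i`-th vertical vector isolates `a i`: the other term vanishes as a vertical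
  -- vector has no first component.
  have ha : a = 0 := by
    funext i
    have h3 := h1 (0, Pi.single i 1)
    rw [constraintForm_apply] at h3
    have h4 : constraintFrame κ D m y (0, Pi.single i 1) = (0, Pi.single i 1) :=
      Prod.ext (map_zero ((frameAt D m.1).inChart m.1 y.1)) rfl
    rw [h4] at h3
    have h5 := h2 a (Pi.single i 1)
    simp only [Pi.single_apply, mul_ite, mul_one, mul_zero, Finset.sum_ite_eq',
      Finset.mem_univ, if_true] at h5
    rw [map_zero, sub_zero] at h3
    exact h5.symm.trans h3
  subst ha
  -- Now `u` is vertical, and pairing with the lift of the `i`-th frame vector gives `-w i`.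
  have hw : w = 0 := by
    funext i
    have h3 := h1 (Pi.single i 1, 0)
    rw [constraintForm_apply] at h3
    have h4 : constraintFrame κ D m y (0, w) = (0, w) :=
      Prod.ext (map_zero ((frameAt D m.1).inChart m.1 y.1)) rfl
    rw [h4] at h3
    have h5 := h2 (Pi.single i 1) w
    simp only [Pi.single_apply, ite_mul, one_mul, zero_mul, Finset.sum_ite_eq',
      Finset.mem_univ, if_true] at h5
    rw [map_zero, zero_sub, neg_eq_zero] at h3
    exact h5.symm.trans h3
  subst hw
  exact haw.symm.trans (map_zero _)

theorem bijective_restrictForm [FiniteDimensional ℝ E] (m : ConstraintManifold κ D) :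
    Bijective (restrictForm (constraintForm κ D m) (constraintDistribution κ D m)) := by
  have : FiniteDimensional ℝ (TangentSpace (constraintModel E r) m) :=
    inferInstanceAs (FiniteDimensional ℝ (E × (Fin r → ℝ)))
  have hinj : Injective
      (restrictForm (constraintForm κ D m) (constraintDistribution κ D m)) := by
    rw [injective_iff_map_eq_zero]
    rintro ⟨u, hu⟩ h
    refine Subtype.ext (constraintForm_nondegenerate m hu fun v hv ↦ ?_)
    exact congrArg (fun L : Module.Dual ℝ (constraintDistribution κ D m) ↦ L ⟨v, hv⟩) h
  exact ⟨hinj, (LinearMap.injective_iff_surjective_of_finrank_eq_finrank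
    Subspace.dual_finrank_eq.symm).1 hinj⟩

end ConstraintFrame

/-! ### Independence of the curvature from the chosen extensions. -/

section Curvature

variable {E : Type*} [NormedAddCommGroup E] [NormedSpace ℝ E] {H : Type*} [TopologicalSpace H]
  {I : ModelWithCorners ℝ E H} {M : Type*} [TopologicalSpace M] [ChartedSpace H M]
  [IsManifold I ∞ M] {C W : ∀ x : M, Submodule ℝ (TangentSpace I x)}

attribute [local instance] isManifold_one_of_smooth

theorem curvature_mem (h : ∀ x, IsCompl (C x) (W x)) (x : M) (u v : TangentSpace I x) :
    curvature h x u v ∈ W x :=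
  (W x).neg_mem (Submodule.projection_apply_mem _ _)

/-- `curvatureField_eq` involves only the values of the two fields at `x`, and the chosen extensions
share these values. -/
theorem curvature_eq_curvatureField [FiniteDimensional ℝ E] [I.Boundaryless]
    (h : ∀ x, IsCompl (C x) (W x)) {x : M}
    (hP : DifferentiableAt ℝ (projInChart h x) (extChartAt I x x))
    {X Y : ∀ z : M, TangentSpace I z}
    (hX : ContMDiffAt I I.tangent ∞ (fun z ↦ (⟨z, X z⟩ : TangentBundle I M)) x)
    (hY : ContMDiffAt I I.tangent ∞ (fun z ↦ (⟨z, Y z⟩ : TangentBundle I M)) x) :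
    curvature h x (X x) (Y x) = curvatureField h X Y x := by
  have hd : ∀ {X : ∀ z : M, TangentSpace I z},
      ContMDiffAt I I.tangent ∞ (fun z ↦ (⟨z, X z⟩ : TangentBundle I M)) x →
      DifferentiableAt ℝ (fieldInChart x X) (extChartAt I x x) := fun hX ↦
    (contDiffAt_fieldInChart le_rfl hX).differentiableAt (by simp)
  have he : ∀ u : TangentSpace I x,
      DifferentiableAt ℝ (fieldInChart x (FiberBundle.extend E u)) (extChartAt I x x) :=
    fun u ↦ hd (FiberBundle.contMDiffAt_extend I E u)
  rw [curvature, curvatureField_eq h hP (he _) (he _), curvatureField_eq h hP (hd hX) (hd hY)]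
  simp only [FiberBundle.extend_apply_self]
  rfl

end Curvature

/-! ### The exterior derivative of `Ω_M - B`. -/

section ExteriorDerivative

variable {E : Type*} [NormedAddCommGroup E] [NormedSpace ℝ E]
  {Q : Type*} [TopologicalSpace Q] [ChartedSpace E Q] [IsManifold 𝓘(ℝ, E) ∞ Q] {r : ℕ}
  {κ : KineticMetric E Q} {D : RegularDistribution 𝓘(ℝ, E) Q r}

theorem DiffForm.inChart_sub {H : Type*} [TopologicalSpace H] {I : ModelWithCorners ℝ E H}
    {M : Type*} [TopologicalSpace M] [ChartedSpace H M] {k : ℕ} (η θ : DiffForm I M k) (x : M) :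
    (η - θ).inChart x = η.inChart x - θ.inChart x := rfl

attribute [local instance] isManifold_one_of_smooth

/-- `Ω_M` is closed, so only `B` contributes; this is the origin of the term `dB` in the final
formula. -/
theorem d_constraintForm_sub {B : DiffForm (constraintModel E r) (ConstraintManifold κ D) 2}
    {m : ConstraintManifold κ D}
    (hB : DifferentiableAt ℝ (B.inChart m) (extChartAt (constraintModel E r) m m))
    (v : Fin 3 → TangentSpace (constraintModel E r) m) :
    (constraintForm κ D - B).d m v = -B.d m v := by
  rw [DiffForm.d_apply, DiffForm.d_apply, DiffForm.inChart_sub, sub_eq_add_neg]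
  have h := extDeriv_add (differentiableAt_constraintForm_inChart m) hB.neg
  have h' := extDeriv_smul (-1 : ℝ) (B.inChart m) (x := extChartAt (constraintModel E r) m m)
  rw [neg_one_smul, neg_one_smul] at h'
  refine (congrArg (fun η : (E × (Fin r → ℝ)) [⋀^Fin 3]→L[ℝ] ℝ ↦ η v)
    (h.trans (congrArg₂ _ (extDeriv_constraintForm_inChart m) h'))).trans ?_
  rw [zero_add]
  rfl

end ExteriorDerivative

end Nonholonomic

end

/-! ### The Jacobiator of the gauge-transformed nonholonomic bivector field. -/

theorem mainTheorem1 {E : Type*} [NormedAddCommGroup E] [NormedSpace ℝ E] [FiniteDimensional ℝ E]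
    {Q : Type*} [TopologicalSpace Q] [ChartedSpace E Q] [IsManifold 𝓘(ℝ, E) ∞ Q] {r s : ℕ}
    (κ : KineticMetric E Q) (D : RegularDistribution 𝓘(ℝ, E) Q r)
    (W : RegularDistribution (constraintModel E r) (ConstraintManifold κ D) s)
    (hW : ∀ m, IsCompl (constraintDistribution κ D m) (W.fiber m))
    (B : DiffForm (constraintModel E r) (ConstraintManifold κ D) 2) (hB : B.IsSmooth)
    (hBW : ∀ m, ∀ z ∈ W.fiber m, ∀ v, B m ![z, v] = 0)
    (πB : Bivector (constraintModel E r) (ConstraintManifold κ D))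
    (hπB : IsGaugeTransform (nonholonomicBivector κ D) B πB) :
    -- the value of `K_W` at a point is that of the vector field `-P_W [P_C X, P_C Y]`
    (∀ m, ∀ X Y : ∀ x : ConstraintManifold κ D, TangentSpace (constraintModel E r) x,
      ContMDiffAt (constraintModel E r) (constraintModel E r).tangent ∞
        (fun x ↦ (⟨x, X x⟩ : TangentBundle (constraintModel E r) (ConstraintManifold κ D))) m →
      ContMDiffAt (constraintModel E r) (constraintModel E r).tangent ∞
        (fun x ↦ (⟨x, Y x⟩ : TangentBundle (constraintModel E r) (ConstraintManifold κ D))) m →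
      curvature hW m (X m) (Y m) = curvatureField hW X Y m) ∧
    -- the Jacobiator formula
    ∀ m, ∀ α β γ : TangentSpace (constraintModel E r) m →L[ℝ] ℝ,
      1 / 2 * schouten πB πB m α β γ =
        ((constraintForm κ D m ![curvature hW m (πB m α) (πB m β), πB m γ]
            - γ (curvature hW m (πB m α) (πB m β))) +
          (constraintForm κ D m ![curvature hW m (πB m β) (πB m γ), πB m α]
            - α (curvature hW m (πB m β) (πB m γ))) +
          (constraintForm κ D m ![curvature hW m (πB m γ) (πB m α), πB m β]
            - β (curvature hW m (πB m γ) (πB m α)))) +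
        B.d m ![πB m α, πB m β, πB m γ] := by
  refine ⟨fun m X Y hX hY ↦ ?_, fun m α β γ ↦ ?_⟩
  · obtain ⟨f, hf⟩ := W.exists_frame m
    exact curvature_eq_curvatureField hW (differentiableAt_projInChart hW
      (isFrameInChart_constraintFrame m) (f.isFrameInChart hf)) hX hY
  · obtain ⟨f, hf⟩ := W.exists_frame m
    have hBd : DifferentiableAt ℝ (B.inChart m) (extChartAt (constraintModel E r) m m) :=
      (hB m).differentiableAt (by simp)
    have hΩ : DifferentiableAt ℝ ((constraintForm κ D - B).inChart m)
        (extChartAt (constraintModel E r) m m) :=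
      (differentiableAt_constraintForm_inChart m).sub hBd
    have h := schouten_eq_of_form hW (isFrameInChart_constraintFrame m) (f.isFrameInChart hf) hΩ
      (fun z α ↦ IsGaugeTransform.mem hπB z α)
      (fun z α v hv ↦ IsGaugeTransform.form_eq hπB (bijective_restrictForm z) α hv)
      (fun u hu ↦ IsGaugeTransform.nondegenerate hπB (bijective_restrictForm m) hu) α β γ
    -- The curvature takes values in `W`, which `B` annihilates, so the curvature terms for `Ω_M -
    -- B` are those for `Ω_M`.
    have hsub : ∀ u v w, (constraintForm κ D - B) m ![curvature hW m u v, w] =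
        constraintForm κ D m ![curvature hW m u v, w] := fun u v w ↦
      (congrArg (fun t ↦ constraintForm κ D m ![curvature hW m u v, w] - t)
        (hBW m _ (curvature_mem hW m u v) w)).trans (sub_zero _)
    rw [h, hsub, hsub, hsub, d_constraintForm_sub hBd, sub_neg_eq_add]
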